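/- Let $\alpha\in\mathbb C$, let $\theta\in\mathbb R$ and let $p\ge 1$ be an integer. Let $\gamma_0,\gamma_1,\dots$ be the coefficients of the expansion, near $\xi=1$, $$\xi^{\theta}\Big(\frac{-\ln \xi}{1-\xi}\Big)^{-\alpha}=\sum_{i=0}^{\infty}\gamma_i(1-\xi)^i ,$$ and let the weights $\omega_0,\omega_1,\dots$ be generated by $$\omega(\xi)=\sum_{j=0}^{\infty}\omega_j\xi^j=(1-\xi)^{-\alpha}\big[\gamma_0+\gamma_1(1-\xi)+\cdots+\gamma_{p-1}(1-\xi)^{p-1}\big],\qquad |\xi|<1$$ (principal branches). Then the shifted convolution quadrature with shift $\theta$ and weights $\omega_j$ is convergent of order $p$ to the Riemann–Liouville operator $I^\alpha$. That is, for every $\beta\in\mathbb C$ with $\beta\neq 0,-1,-2,\dots$, writing $h=1/(n-\theta)$, so that the node $(n-\theta)h$ is the point $1$, one has $$(E_h^\alpha t^{\beta-1})(1):=h^{\alpha}\sum_{j=0}^{n}\omega_j\, f\big(1+(\theta-j)h\big)-(I^{\alpha}f)(1)=O(h^{\beta})+O(h^{p})\qquad (n\to\infty),\qquad f(t)=t^{\beta-1},$$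 where $f(0)$ is read as $1$ if $\beta=1$ and as $0$ otherwise. Here $I^{\alpha}f(x)=\frac1{\Gamma(\alpha)}\int_0^x(x-s)^{\alpha-1}f(s)\,ds$ if $\operatorname{Re}\alpha>0$, $I^0f=f$, and for all other $\alpha$, $I^{\alpha}f=\frac{d^k}{dx^k}I^{\alpha+k}f$ with the least $k\in\mathbb N$ such that $\operatorname{Re}(\alpha+k)>0$ or $\alpha+k=0$. If $\operatorname{Re}\beta\le 0$, then $t^{\beta-1}$ is understood as a finite part, that is, $I^{\alpha}t^{\beta-1}=\frac{1}{\beta(\beta+1)\cdots(\beta+m-1)}\frac{d^m}{dx^m}I^{\alpha}t^{\beta+m-1}$ with the least $m\in\mathbb N$ such that $\operatorname{Re}(\beta+m)>0$. -/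

import Mathlib

open Filter Topology Asymptotics

namespace SCQ

/-! ### The Riemann-Liouville operator of complex order -/

/-- The Riemann-Liouville integral
`(I^α f)(x) = 1/Γ(α) ∫_0^x (x-s)^(α-1) f(s) ds` (for `Re α > 0`), and `I^0 = id`. -/
noncomputable def rlIntegral (α : ℂ) (f : ℝ → ℂ) (x : ℝ) : ℂ :=
  if α = 0 then f x
  else 1 / Complex.Gamma α * ∫ s in (0 : ℝ)..x, ((x - s : ℝ) : ℂ) ^ (α - 1) * f s

/-- The number of derivatives in the Riemann-Liouville operator of order `α`: the least `n`
for which `I^(α+n)` is an integral operator (`Re (α+n) > 0`) or the identity (`α + n = 0`).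
It is `0` for `Re α > 0`, and `⌈-Re α⌉` for `Re α ≤ 0`, except that it is `1 - Re α` if `Re α` is
an integer `≤ 0` and `α` is not real (there the integral of order `α + ⌈-Re α⌉` diverges). -/
noncomputable def rlOrder (α : ℂ) : ℕ :=
  sInf {n : ℕ | α + n = 0 ∨ 0 < (α + n).re}

/-- The Riemann-Liouville operator `I^α = (d/dx)^n I^(α+n)`, for every `α ∈ ℂ`. -/
noncomputable def rl (α : ℂ) (f : ℝ → ℂ) : ℝ → ℂ :=
  iteratedDeriv (rlOrder α) (rlIntegral (α + rlOrder α) f)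

/-- The function `t ↦ t^(β-1)`. (At `t = 0` this takes the value `1` for `β = 1` and `0` otherwise.)
-/
noncomputable def power (β : ℂ) (t : ℝ) : ℂ := (t : ℂ) ^ (β - 1)

/-- The least `m` for which `t^(β+m-1)` is integrable at `0`. -/
noncomputable def powerOrder (β : ℂ) : ℕ :=
  sInf {m : ℕ | 0 < (β + m).re}

/-- `I^α t^(β-1)` for every `α ∈ ℂ` and every `β ≠ 0, -1, -2, …`. For `Re β > 0` one has `m = 0`, and
this is `I^α` applied to the locally integrable function `t^(β-1)`. For `Re β ≤ 0` the function
`t^(β-1)` is not integrable at `0` and, as usual, stands for its finite part, that is for the `m`-th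
derivative of the locally integrable function `t^(β+m-1) / (β (β+1) ⋯ (β+m-1))`. -/
noncomputable def rlPower (α β : ℂ) (x : ℝ) : ℂ :=
  (∏ i ∈ Finset.range (powerOrder β), (β + i))⁻¹ *
    iteratedDeriv (powerOrder β) (rl α (power (β + powerOrder β))) x

/-! ### Shifted convolution quadratures -/

/-- The convolution part of the shifted convolution quadrature at the node `x = (n-θ)h`:
`(Ω_h^α f)(x) = h^α ∑_{j=0}^n ω_j f(x + (θ-j)h)`. -/
noncomputable def convPart (α : ℂ) (θ : ℝ) (ω : ℕ → ℂ) (h : ℝ) (f : ℝ → ℂ) (n : ℕ) : ℂ :=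
  (h : ℂ) ^ α * ∑ j ∈ Finset.range (n + 1), ω j * f (((n : ℝ) - θ) * h + (θ - j) * h)

/-- The mesh size `h` for which the `n`-th shifted node `(n-θ)h` is the point `1`. -/
noncomputable def mesh (θ : ℝ) (n : ℕ) : ℝ := 1 / ((n : ℝ) - θ)

/-- The quadrature error `(E_h^α t^(β-1))(1) = (Ω_h^α t^(β-1))(1) - (I^α t^(β-1))(1)`, for the
mesh size `h` with `(n-θ)h = 1`. -/
noncomputable def errorAtOne (α : ℂ) (θ : ℝ) (ω : ℕ → ℂ) (β : ℂ) (n : ℕ) : ℂ :=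
  convPart α θ ω (mesh θ n) (power β) n - rlPower α β 1

/-- The shifted convolution quadrature with shift `θ` and convolution weights `ω` is convergent
of order `p` to `I^α`: `(E_h^α t^(β-1))(1) = O(h^β) + O(h^p)` as `h → 0`, for every complex
`β ≠ 0, -1, -2, …`. -/
def Convergent (α : ℂ) (θ : ℝ) (p : ℕ) (ω : ℕ → ℂ) : Prop :=
  ∀ β : ℂ, (∀ k : ℕ, β ≠ -(k : ℂ)) →
    (fun n : ℕ => errorAtOne α θ ω β n) =O[atTop]
      (fun n : ℕ => ‖((mesh θ n : ℝ) : ℂ) ^ β‖ + mesh θ n ^ p)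

/-- The weights generated by a function `ω(ξ) = ∑ ω_j ξ^j` analytic at `0`. -/
noncomputable def weights (ω : ℂ → ℂ) (j : ℕ) : ℂ :=
  iteratedDeriv j ω 0 / (j.factorial : ℂ)

/-! ### The shift-generalized Newton-Gregory formula -/

/-- `ξ^θ ((-ln ξ)/(1-ξ))^(-α)`, with its removable singularity at `ξ = 1` removed. -/
noncomputable def ngFactor (α : ℂ) (θ : ℝ) (ξ : ℂ) : ℂ :=
  if ξ = 1 then 1 else ξ ^ (θ : ℂ) * (-Complex.log ξ / (1 - ξ)) ^ (-α)

/-- The coefficients `γ_i` of `ξ^θ ((-ln ξ)/(1-ξ))^(-α)` in powers of `1 - ξ`. -/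
noncomputable def ngCoeff (α : ℂ) (θ : ℝ) (i : ℕ) : ℂ :=
  (-1) ^ i * iteratedDeriv i (ngFactor α θ) 1 / (i.factorial : ℂ)

/-- `ω(ξ) = (1-ξ)^(-α) [γ_0 + γ_1 (1-ξ) + ⋯ + γ_{p-1} (1-ξ)^(p-1)]`. -/
noncomputable def ngGen (α : ℂ) (θ : ℝ) (p : ℕ) (ξ : ℂ) : ℂ :=
  (1 - ξ) ^ (-α) * ∑ i ∈ Finset.range p, ngCoeff α θ i * (1 - ξ) ^ i

/-! ### The two power series expansions hold -/

theorem ngGen_hasSum (α : ℂ) (θ : ℝ) (p : ℕ) {ξ : ℂ} (hξ : ‖ξ‖ < 1) :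
    HasSum (fun j : ℕ => weights (ngGen α θ p) j * ξ ^ j) (ngGen α θ p ξ) := by
  have hd : DifferentiableOn ℂ (ngGen α θ p) (Metric.ball 0 1) := by
    intro z hz
    have hz' : ‖z‖ < 1 := by simpa using hz
    have hs : (1 - z) ∈ Complex.slitPlane := by
      left
      have := (Complex.abs_re_le_norm z).trans_lt hz'
      have := (abs_lt.mp this).2
      simp only [Complex.sub_re, Complex.one_re]; linarith
    unfold ngGen
    refine DifferentiableAt.differentiableWithinAt ?_
    refine DifferentiableAt.mul ?_ (by fun_prop)
    exact DifferentiableAt.cpow (by fun_prop) (by fun_prop) hs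
  have := Complex.hasSum_taylorSeries_on_ball (r := 1) (c := 0) (by simpa using hd)
    (z := ξ) (by simpa using hξ)
  suffices he : (fun j : ℕ => weights (ngGen α θ p) j * ξ ^ j) = fun n : ℕ =>
      ((n.factorial : ℂ))⁻¹ • (ξ - 0) ^ n • iteratedDeriv n (ngGen α θ p) 0 by
    rw [he]; exact this
  funext j
  simp only [weights, sub_zero, smul_eq_mul]
  ring

theorem ngFactor_analyticAt (α : ℂ) (θ : ℝ) : AnalyticAt ℂ (ngFactor α θ) 1 := by
  have hl : Tendsto (fun ξ : ℂ => -Complex.log ξ / (1 - ξ)) (𝓝[≠] 1) (𝓝 1) := by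
    have h := (Complex.hasStrictDerivAt_log (x := 1) (by simp)).hasDerivAt
    rw [hasDerivAt_iff_tendsto_slope] at h
    simp only [inv_one] at h
    refine h.congr fun ξ => ?_
    rw [slope_def_field, Complex.log_one, sub_zero, ← neg_sub ξ 1, neg_div_neg_eq]
  have hc : ContinuousAt (ngFactor α θ) 1 := by
    rw [continuousAt_iff_punctured_nhds]
    have h1 : Tendsto (fun ξ : ℂ => ξ ^ (θ : ℂ)) (𝓝[≠] 1) (𝓝 ((1 : ℂ) ^ (θ : ℂ))) :=
      (continuousAt_cpow_const (by simp)).tendsto.mono_left nhdsWithin_le_nhds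
    have h2 : Tendsto (fun ξ : ℂ => (-Complex.log ξ / (1 - ξ)) ^ (-α)) (𝓝[≠] 1)
        (𝓝 ((1 : ℂ) ^ (-α))) :=
      (continuousAt_cpow_const (by simp)).tendsto.comp hl
    have h3 := h1.mul h2
    simp only [Complex.one_cpow, mul_one] at h3
    have : ngFactor α θ 1 = 1 := by simp [ngFactor]
    rw [this]
    refine h3.congr' ?_
    filter_upwards [self_mem_nhdsWithin] with ξ hξ
    simp [ngFactor, show ξ ≠ 1 from hξ]
  refine Complex.analyticAt_of_differentiable_on_punctured_nhds_of_continuousAt ?_ hc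
  have e1 : ∀ᶠ ξ : ℂ in 𝓝[≠] 1, -Complex.log ξ / (1 - ξ) ∈ Complex.slitPlane :=
    hl.eventually (Complex.isOpen_slitPlane.mem_nhds (by simp))
  have e2 : ∀ᶠ ξ : ℂ in 𝓝[≠] 1, ξ ∈ Complex.slitPlane :=
    nhdsWithin_le_nhds (Complex.isOpen_slitPlane.mem_nhds (by simp))
  filter_upwards [e1, e2, self_mem_nhdsWithin] with ξ h1 h2 h3
  have h3' : ξ ≠ 1 := h3
  have h4 : (1 : ℂ) - ξ ≠ 0 := sub_ne_zero.mpr (Ne.symm h3')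
  have hd : DifferentiableAt ℂ
      (fun ξ : ℂ => ξ ^ (θ : ℂ) * (-Complex.log ξ / (1 - ξ)) ^ (-α)) ξ := by
    refine DifferentiableAt.mul (DifferentiableAt.cpow (by fun_prop) (by fun_prop) h2) ?_
    refine DifferentiableAt.cpow ?_ (by fun_prop) h1
    exact (DifferentiableAt.neg (Complex.differentiableAt_log h2)).div (by fun_prop) h4
  refine hd.congr_of_eventuallyEq ?_
  filter_upwards [isOpen_ne.mem_nhds h3'] with z hz
  simp [ngFactor, show z ≠ 1 from hz]

theorem ngCoeff_hasSum (α : ℂ) (θ : ℝ) :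
    ∀ᶠ ξ : ℂ in 𝓝[≠] 1, HasSum (fun i : ℕ => ngCoeff α θ i * (1 - ξ) ^ i)
      (ξ ^ (θ : ℂ) * (-Complex.log ξ / (1 - ξ)) ^ (-α)) := by
  obtain ⟨r, hr, hd⟩ := Metric.eventually_nhds_iff_ball.mp
    (ngFactor_analyticAt α θ).eventually_analyticAt
  have hb : ∀ᶠ ξ : ℂ in 𝓝[≠] 1, ξ ∈ Metric.ball (1 : ℂ) r :=
    nhdsWithin_le_nhds (Metric.ball_mem_nhds _ hr)
  filter_upwards [hb, self_mem_nhdsWithin] with ξ hξ h1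
  have h := Complex.hasSum_taylorSeries_on_ball (f := ngFactor α θ) (c := 1) (r := r)
    (fun z hz => (hd z hz).differentiableAt.differentiableWithinAt) hξ
  have he : ngFactor α θ ξ = ξ ^ (θ : ℂ) * (-Complex.log ξ / (1 - ξ)) ^ (-α) := by
    simp [ngFactor, show ξ ≠ 1 from h1]
  rw [he] at h
  suffices hs : (fun i : ℕ => ngCoeff α θ i * (1 - ξ) ^ i) = fun n : ℕ =>
      ((n.factorial : ℂ))⁻¹ • (ξ - 1) ^ n • iteratedDeriv n (ngFactor α θ) 1 by
    rw [hs]; exact h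
  funext i
  simp only [ngCoeff, smul_eq_mul]
  rw [show (1 : ℂ) - ξ = (-1) * (ξ - 1) by ring, mul_pow]
  have : ((-1 : ℂ) ^ i) * (-1) ^ i = 1 := by rw [← mul_pow]; simp
  linear_combination (iteratedDeriv i (ngFactor α θ) 1 / (i.factorial : ℂ) * (ξ - 1) ^ i) * this

end SCQ

/-! With `x = (n-θ)h = 1` every node is `(n-j)h`, so the quadrature of `t^(β-1)` is `h^(α+β-1)`
times the convolution of the weights with `k^(β-1)`, while the exact value is `Γ(β)/Γ(α+β)`. Let
`b_s(n)` be the coefficient of `ξ^n` in `(1-ξ)^(-s)`. The weights are `∑_{i<p} γ_i(α,θ) b_{α-i}`,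
and convolution adds the orders of the `b`'s.

The key fact (`expansionError_isBigO`) is that the same `γ`'s expand shifted powers:
`(n-θ)^(s-1)/Γ(s) = ∑_{l<p} γ_l(s,θ) b_{s-l}(n) + O(n^(Re s-1-p))`. It is used twice. With shift
`0`, order `β` and many terms `M`, it replaces `k^(β-1)` by a combination of the `b_{β-m}`; the
rapidly decaying remainder, convolved with the weights, is `O(n^(Re α-1))` and contributes `O(h^β)`.
In the resulting double sum the terms of total degree below `p` combine, since `γ(α,θ)` and `γ(β,0)`
have Cauchy product `γ(α+β,θ)`, to the expansion of `(n-θ)^(α+β-1)/Γ(α+β)`. This cancels the exact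
value up to `O(h^p)`, and the terms of degree at least `p` are `O(h^p)` as well.

For `Re s < 1` the key fact is Watson's lemma: `(n-θ)^(s-1)` and `b_{s-l}(n)` are, up to constants,
Laplace transforms of `t^(-s) e^(θt)` and `(e^t-1)^(l-s)`, and `ξ = e^t` turns the Taylor expansion
defining the `γ_l` into a comparison of these functions at `t = 0`. A recursion `s → s+1`
(`expansionError_succ`) reaches all other `s`. -/

namespace SCQ

/-! ### Taylor coefficients -/

/-- The `n`-th Taylor coefficient of `f` at `z`. -/
noncomputable def taylorCoeff (f : ℂ → ℂ) (z : ℂ) (n : ℕ) : ℂ :=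
  iteratedDeriv n f z / (n.factorial : ℂ)

theorem taylorCoeff_congr {f g : ℂ → ℂ} {z : ℂ} (h : f =ᶠ[𝓝 z] g) (n : ℕ) :
    taylorCoeff f z n = taylorCoeff g z n := by
  unfold taylorCoeff
  rw [h.iteratedDeriv_eq n]

theorem taylorCoeff_mul {f g : ℂ → ℂ} {z : ℂ} (hf : AnalyticAt ℂ f z) (hg : AnalyticAt ℂ g z)
    (n : ℕ) : taylorCoeff (f * g) z n =
      ∑ i ∈ Finset.range (n + 1), taylorCoeff f z i * taylorCoeff g z (n - i) := by
  unfold taylorCoeff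
  rw [iteratedDeriv_mul hf.contDiffAt hg.contDiffAt, Finset.sum_div]
  refine Finset.sum_congr rfl fun i hi => ?_
  have hi' : i ≤ n := Nat.lt_succ_iff.mp (Finset.mem_range.mp hi)
  rw [Nat.cast_choose ℂ hi']
  have h1 : (n.factorial : ℂ) ≠ 0 := by exact_mod_cast n.factorial_ne_zero
  have h2 : (i.factorial : ℂ) ≠ 0 := by exact_mod_cast i.factorial_ne_zero
  have h3 : ((n - i).factorial : ℂ) ≠ 0 := by exact_mod_cast (n - i).factorial_ne_zero
  field_simp

theorem taylorCoeff_add {f g : ℂ → ℂ} {z : ℂ} (hf : AnalyticAt ℂ f z) (hg : AnalyticAt ℂ g z)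
    (n : ℕ) : taylorCoeff (f + g) z n = taylorCoeff f z n + taylorCoeff g z n := by
  unfold taylorCoeff
  rw [iteratedDeriv_add hf.contDiffAt hg.contDiffAt, add_div]

theorem taylorCoeff_const_mul {f : ℂ → ℂ} {z : ℂ} (c : ℂ) (n : ℕ) :
    taylorCoeff (fun w => c * f w) z n = c * taylorCoeff f z n := by
  unfold taylorCoeff
  rw [iteratedDeriv_const_mul_field, mul_div_assoc]

theorem taylorCoeff_deriv (f : ℂ → ℂ) (z : ℂ) (n : ℕ) :
    taylorCoeff (deriv f) z n = (n + 1) * taylorCoeff f z (n + 1) := by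
  unfold taylorCoeff
  rw [iteratedDeriv_succ', Nat.factorial_succ]
  have h1 : (n.factorial : ℂ) ≠ 0 := by exact_mod_cast n.factorial_ne_zero
  have h2 : (n + 1 : ℂ) ≠ 0 := by exact_mod_cast n.succ_ne_zero
  push_cast
  field_simp

theorem taylorCoeff_sum {ι : Type*} (s : Finset ι) {f : ι → ℂ → ℂ} {z : ℂ}
    (hf : ∀ i ∈ s, AnalyticAt ℂ (f i) z) (n : ℕ) :
    taylorCoeff (fun w => ∑ i ∈ s, f i w) z n = ∑ i ∈ s, taylorCoeff (f i) z n := by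
  unfold taylorCoeff
  rw [iteratedDeriv_fun_sum fun i hi => (hf i hi).contDiffAt, Finset.sum_div]

theorem taylorCoeff_sub_mul_zero (f : ℂ → ℂ) (z : ℂ) :
    taylorCoeff (fun w => (w - z) * f w) z 0 = 0 := by
  simp [taylorCoeff]

theorem taylorCoeff_sub_mul_succ {f : ℂ → ℂ} {z : ℂ} (hf : AnalyticAt ℂ f z) (n : ℕ) :
    taylorCoeff (fun w => (w - z) * f w) z (n + 1) = taylorCoeff f z n := by
  have h := taylorCoeff_mul (f := fun w : ℂ => w - z) (by fun_prop) hf (n + 1)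
  have h0 : taylorCoeff (fun w : ℂ => w - z) z 0 = 0 := by simp [taylorCoeff]
  have hd : deriv (fun w : ℂ => w - z) = fun _ => 1 := by
    funext w
    simp
  have h1 : ∀ i, taylorCoeff (fun w : ℂ => w - z) z (i + 2) = 0 := by
    intro i
    simp only [taylorCoeff]
    rw [iteratedDeriv_succ', hd, iteratedDeriv_const]
    simp
  have h2 : taylorCoeff (fun w : ℂ => w - z) z 1 = 1 := by
    simp [taylorCoeff]
  change taylorCoeff ((fun w : ℂ => w - z) * f) z (n + 1) = _
  rw [h, Finset.sum_range_succ', Finset.sum_range_succ']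
  simp [h0, h1, h2]

/-! ### The coefficients of `(1-ξ)^(-s)` -/

/-- The coefficient of `ξ^n` in `(1-ξ)^(-s)`. -/
noncomputable def binCoeff (s : ℂ) (n : ℕ) : ℂ := ∏ k ∈ Finset.range n, (s + k) / (k + 1)

theorem binCoeff_succ (s : ℂ) (n : ℕ) :
    binCoeff s (n + 1) = binCoeff s n * ((s + n) / (n + 1)) :=
  Finset.prod_range_succ _ _

theorem one_sub_mem_slitPlane {z : ℂ} (hz : ‖z‖ < 1) : 1 - z ∈ Complex.slitPlane := by
  left
  have := (abs_lt.mp ((Complex.abs_re_le_norm z).trans_lt hz)).2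
  simp only [Complex.sub_re, Complex.one_re]
  linarith

theorem analyticAt_one_sub_cpow (s : ℂ) : AnalyticAt ℂ (fun z : ℂ => (1 - z) ^ s) 0 :=
  AnalyticAt.cpow (by fun_prop) (by fun_prop) (one_sub_mem_slitPlane (by simp))

theorem iteratedDeriv_one_sub_cpow (s : ℂ) (n : ℕ) {z : ℂ} (hz : ‖z‖ < 1) :
    iteratedDeriv n (fun w : ℂ => (1 - w) ^ (-s)) z =
      (∏ k ∈ Finset.range n, (s + k)) * (1 - z) ^ (-s - n) := by
  induction n generalizing z with
  | zero => simp
  | succ n ih =>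
    have he : iteratedDeriv n (fun w : ℂ => (1 - w) ^ (-s)) =ᶠ[𝓝 z]
        fun w => (∏ k ∈ Finset.range n, (s + k)) * (1 - w) ^ (-s - n) := by
      have hm : {w : ℂ | ‖w‖ < 1} ∈ 𝓝 z :=
        (isOpen_lt continuous_norm continuous_const).mem_nhds hz
      filter_upwards [hm] with w hw using ih hw
    rw [iteratedDeriv_succ, he.deriv_eq]
    have hd : HasDerivAt (fun w : ℂ => (1 - w) ^ (-s - n))
        ((-s - n) * (1 - z) ^ (-s - n - 1) * (-1)) z :=
      ((hasDerivAt_id z).const_sub 1).cpow_const (one_sub_mem_slitPlane hz)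
    rw [(hd.const_mul _).deriv, Finset.prod_range_succ]
    push_cast
    rw [show -s - (n + 1 : ℂ) = -s - n - 1 by ring]
    ring

theorem taylorCoeff_one_sub_cpow (s : ℂ) (n : ℕ) :
    taylorCoeff (fun z : ℂ => (1 - z) ^ (-s)) 0 n = binCoeff s n := by
  unfold taylorCoeff binCoeff
  rw [iteratedDeriv_one_sub_cpow s n (by simp), Finset.prod_div_distrib]
  simp only [sub_zero, Complex.one_cpow, mul_one]
  congr 1
  rw [← Finset.prod_range_add_one_eq_factorial]
  push_cast
  rfl

/-- Cauchy product of `(1-ξ)^(-s)` and `(1-ξ)^(-t)`. -/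
theorem binCoeff_add (s t : ℂ) (n : ℕ) :
    binCoeff (s + t) n =
      ∑ j ∈ Finset.range (n + 1), binCoeff s j * binCoeff t (n - j) := by
  simp only [← taylorCoeff_one_sub_cpow]
  rw [← taylorCoeff_mul (analyticAt_one_sub_cpow _) (analyticAt_one_sub_cpow _)]
  refine taylorCoeff_congr ?_ n
  have hm : {w : ℂ | ‖w‖ < 1} ∈ 𝓝 (0 : ℂ) :=
    (isOpen_lt continuous_norm continuous_const).mem_nhds (by simp)
  filter_upwards [hm] with w hw
  simp only [Pi.mul_apply]
  rw [← Complex.cpow_add _ _ (Complex.slitPlane_ne_zero (one_sub_mem_slitPlane hw))]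
  ring_nf

/-- For generating functions this is `ξ d/dξ (1-ξ)^(-s) = s ((1-ξ)^(-s-1) - (1-ξ)^(-s))`. -/
theorem natCast_mul_binCoeff (s : ℂ) (n : ℕ) :
    n * binCoeff s n = s * (binCoeff (s + 1) n - binCoeff s n) := by
  have h : s * binCoeff (s + 1) n = (s + n) * binCoeff s n := by
    induction n with
    | zero => simp [binCoeff]
    | succ n ih =>
      have h2 : (n + 1 : ℂ) ≠ 0 := by exact_mod_cast n.succ_ne_zero
      rw [binCoeff_succ, ← mul_assoc, ih, binCoeff_succ]
      push_cast
      field_simp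
      ring
  linear_combination -h

theorem weights_ngGen (α : ℂ) (θ : ℝ) (p n : ℕ) :
    weights (ngGen α θ p) n =
      ∑ i ∈ Finset.range p, ngCoeff α θ i * binCoeff (α - i) n := by
  have h : ngGen α θ p =ᶠ[𝓝 0] fun z => ∑ i ∈ Finset.range p,
      ngCoeff α θ i * (1 - z) ^ (-(α - i)) := by
    have hm : {w : ℂ | ‖w‖ < 1} ∈ 𝓝 (0 : ℂ) :=
      (isOpen_lt continuous_norm continuous_const).mem_nhds (by simp)
    filter_upwards [hm] with w hw
    unfold ngGen
    rw [Finset.mul_sum]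
    refine Finset.sum_congr rfl fun i _ => ?_
    rw [show -(α - i) = -α + i by ring,
      Complex.cpow_add _ _ (Complex.slitPlane_ne_zero (one_sub_mem_slitPlane hw)),
      Complex.cpow_natCast]
    ring
  change taylorCoeff (ngGen α θ p) 0 n = _
  rw [taylorCoeff_congr h, taylorCoeff_sum]
  · refine Finset.sum_congr rfl fun i _ => ?_
    rw [taylorCoeff_const_mul, taylorCoeff_one_sub_cpow]
  · intro i _
    exact analyticAt_const.mul (analyticAt_one_sub_cpow _)

/-! ### Relations between the coefficients `γ_i` -/

theorem ngCoeff_eq (α : ℂ) (θ : ℝ) (i : ℕ) :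
    ngCoeff α θ i = (-1) ^ i * taylorCoeff (ngFactor α θ) 1 i := by
  unfold ngCoeff taylorCoeff
  ring

@[simp] theorem ngFactor_one (α : ℂ) (θ : ℝ) : ngFactor α θ 1 = 1 := by simp [ngFactor]

@[simp] theorem ngCoeff_zero (α : ℂ) (θ : ℝ) : ngCoeff α θ 0 = 1 := by
  simp [ngCoeff]

/-- `(-ln ξ)/(1-ξ)`, with its removable singularity removed. -/
noncomputable def logQuot (ξ : ℂ) : ℂ := ngFactor (-1) 0 ξ

theorem logQuot_analyticAt : AnalyticAt ℂ logQuot 1 := ngFactor_analyticAt (-1) 0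

theorem logQuot_mul (ξ : ℂ) : logQuot ξ * (ξ - 1) = Complex.log ξ := by
  by_cases h1 : ξ = 1
  · simp [h1]
  · have h2 : 1 - ξ ≠ 0 := sub_ne_zero.mpr (Ne.symm h1)
    simp only [logQuot, ngFactor, h1, if_false, neg_neg, Complex.cpow_one, Complex.ofReal_zero,
      Complex.cpow_zero, one_mul]
    field_simp
    ring

theorem ngFactor_eq (α : ℂ) (θ : ℝ) {ξ : ℂ} :
    ngFactor α θ ξ = ξ ^ (θ : ℂ) * logQuot ξ ^ (-α) := by
  by_cases h1 : ξ = 1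
  · simp [h1, logQuot]
  · simp [logQuot, ngFactor, h1]

theorem logQuot_eventually : ∀ᶠ ξ : ℂ in 𝓝 1, logQuot ξ ∈ Complex.slitPlane ∧
    ξ ∈ Complex.slitPlane ∧ AnalyticAt ℂ logQuot ξ := by
  have h1 : ∀ᶠ ξ : ℂ in 𝓝 1, logQuot ξ ∈ Complex.slitPlane :=
    logQuot_analyticAt.continuousAt.eventually
      (Complex.isOpen_slitPlane.mem_nhds (by simp [logQuot]))
  have h2 : ∀ᶠ ξ : ℂ in 𝓝 1, ξ ∈ Complex.slitPlane :=
    Complex.isOpen_slitPlane.mem_nhds (by simp)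
  exact h1.and (h2.and logQuot_analyticAt.eventually_analyticAt)

theorem ngFactor_mul (α β : ℂ) (θ : ℝ) :
    ngFactor α θ * ngFactor β 0 =ᶠ[𝓝 1] ngFactor (α + β) θ := by
  filter_upwards [logQuot_eventually] with ξ h
  simp only [Pi.mul_apply, ngFactor_eq]
  rw [neg_add, Complex.cpow_add _ _ (Complex.slitPlane_ne_zero h.1)]
  simp
  ring

/-- Cauchy product. Only one factor carries `ξ^θ`: the shift belongs to the weights, and the sampled
power is unshifted. -/
theorem ngCoeff_add (α β : ℂ) (θ : ℝ) (n : ℕ) :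
    ngCoeff (α + β) θ n =
      ∑ i ∈ Finset.range (n + 1), ngCoeff α θ i * ngCoeff β 0 (n - i) := by
  rw [ngCoeff_eq, ← taylorCoeff_congr (ngFactor_mul α β θ),
    taylorCoeff_mul (ngFactor_analyticAt _ _) (ngFactor_analyticAt _ _), Finset.mul_sum]
  refine Finset.sum_congr rfl fun i hi => ?_
  have hi' : i ≤ n := Nat.lt_succ_iff.mp (Finset.mem_range.mp hi)
  rw [ngCoeff_eq, ngCoeff_eq]
  nth_rewrite 1 [← Nat.add_sub_cancel' hi']
  rw [pow_add]
  ring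

/-- Differentiating `(ξ-1) · logQuot ξ = log ξ`, rather than a quotient, covers `ξ = 1` as well. -/
theorem deriv_logQuot {ξ : ℂ} (h : ξ ∈ Complex.slitPlane) (ha : AnalyticAt ℂ logQuot ξ) :
    ξ * (deriv logQuot ξ * (ξ - 1) + logQuot ξ) = 1 := by
  have h1 : HasDerivAt (fun z => logQuot z * (z - 1))
      (deriv logQuot ξ * (ξ - 1) + logQuot ξ * 1) ξ :=
    ha.differentiableAt.hasDerivAt.mul ((hasDerivAt_id ξ).sub_const 1)
  have h2 : HasDerivAt (fun z => logQuot z * (z - 1)) ξ⁻¹ ξ := by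
    refine (Complex.hasDerivAt_log h).congr_of_eventuallyEq ?_
    exact Eventually.of_forall fun z => logQuot_mul z
  have h3 := h1.unique h2
  rw [mul_one] at h3
  rw [h3, mul_inv_cancel₀ (Complex.slitPlane_ne_zero h)]

/-- `(ξ d/dξ - θ) (ξ^θ (-ln ξ)^(-s)) = s ξ^θ (-ln ξ)^(-s-1)`, divided by `(1-ξ)^(-s-1)`. -/
theorem deriv_ngFactor (s : ℂ) (θ : ℝ) : ∀ᶠ ξ : ℂ in 𝓝 1,
    s * ξ * ngFactor s θ ξ + (1 - ξ) * (ξ * deriv (ngFactor s θ) ξ - θ * ngFactor s θ ξ) =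
      s * ngFactor (s + 1) θ ξ := by
  filter_upwards [logQuot_eventually] with ξ ⟨hq, hξ, ha⟩
  have hξ0 := Complex.slitPlane_ne_zero hξ
  have hq0 := Complex.slitPlane_ne_zero hq
  have hf : ngFactor s θ = fun z => z ^ (θ : ℂ) * logQuot z ^ (-s) := by
    funext z
    exact ngFactor_eq s θ
  have hd := ((hasDerivAt_id ξ).cpow_const (c := (θ : ℂ)) hξ).mul
    (ha.differentiableAt.hasDerivAt.cpow_const (c := -s) hq)
  have hd' := hd.deriv
  change deriv (fun z => z ^ (θ : ℂ) * logQuot z ^ (-s)) ξ = _ at hd'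
  rw [← hf] at hd'
  rw [hd', ngFactor_eq, ngFactor_eq]
  -- With both exponents lowered by one, the goal is a multiple of the equation for `logQuot`.
  have e1 : ξ ^ (θ : ℂ) = ξ ^ ((θ : ℂ) - 1) * ξ := by
    rw [Complex.cpow_sub _ _ hξ0, Complex.cpow_one, div_mul_cancel₀ _ hξ0]
  have e2 : logQuot ξ ^ (-s) = logQuot ξ ^ (-s - 1) * logQuot ξ := by
    rw [Complex.cpow_sub _ _ hq0, Complex.cpow_one, div_mul_cancel₀ _ hq0]
  rw [show -(s + 1) = -s - 1 by ring]
  have := deriv_logQuot hξ ha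
  simp only [id]
  rw [e1, e2]
  generalize ξ ^ ((θ : ℂ) - 1) = A at *
  generalize logQuot ξ ^ (-s - 1) = B at *
  linear_combination s * A * B * ξ * this

/-- Coefficient of `(ξ-1)^(l+1)` in the differential equation `deriv_ngFactor`, with `ξ` written as
`1 + (ξ-1)`. -/
theorem ngCoeff_succ_right (s : ℂ) (θ : ℝ) (l : ℕ) :
    s * ngCoeff (s + 1) θ (l + 1) =
      (s - (l + 1)) * ngCoeff s θ (l + 1) - (s - l + θ) * ngCoeff s θ l := by
  set F := ngFactor s θ with hF
  have hFa : AnalyticAt ℂ F 1 := ngFactor_analyticAt s θ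
  have hDa : AnalyticAt ℂ (deriv F) 1 := hFa.deriv
  have key : ((fun ξ => s * F ξ) + fun ξ => (ξ - 1) * ((s + θ) * F ξ - deriv F ξ
      - (ξ - 1) * deriv F ξ)) =ᶠ[𝓝 1] fun ξ => s * ngFactor (s + 1) θ ξ := by
    filter_upwards [deriv_ngFactor s θ] with ξ h
    rw [← h]
    simp only [Pi.add_apply, ← hF]
    ring
  have h1 := taylorCoeff_congr key (l + 1)
  have hin : AnalyticAt ℂ (fun ξ => (s + θ) * F ξ - deriv F ξ - (ξ - 1) * deriv F ξ) 1 := by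
    fun_prop
  rw [taylorCoeff_add (by fun_prop) (by fun_prop), taylorCoeff_const_mul, taylorCoeff_const_mul,
    taylorCoeff_sub_mul_succ hin] at h1
  have h2 : taylorCoeff (fun ξ => (s + θ) * F ξ - deriv F ξ - (ξ - 1) * deriv F ξ) 1 l =
      (s + θ) * taylorCoeff F 1 l - (l + 1) * taylorCoeff F 1 (l + 1) - l * taylorCoeff F 1 l := by
    have e : (fun ξ => (s + θ) * F ξ - deriv F ξ - (ξ - 1) * deriv F ξ) =
        (((fun ξ => (s + θ) * F ξ) + fun ξ => (-1) * deriv F ξ) +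
          fun ξ => (-1) * ((ξ - 1) * deriv F ξ)) := by
      funext ξ
      simp only [Pi.add_apply]
      ring
    rw [e, taylorCoeff_add (by fun_prop) (by fun_prop), taylorCoeff_add (by fun_prop)
      (by fun_prop), taylorCoeff_const_mul, taylorCoeff_const_mul, taylorCoeff_const_mul,
      taylorCoeff_deriv]
    cases l with
    | zero =>
      rw [taylorCoeff_sub_mul_zero]
      push_cast
      ring
    | succ l =>
      rw [taylorCoeff_sub_mul_succ hDa, taylorCoeff_deriv]
      push_cast
      ring
  rw [h2] at h1
  rw [ngCoeff_eq, ngCoeff_eq, ngCoeff_eq, ← hF, pow_succ]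
  linear_combination (-1) ^ l * h1

/-! ### The size of the binomial coefficients -/

/-- Written with `Γ⁻¹`, which is `0` at the poles because `Γ` is `0` there by convention. It thus
agrees with the entire function `1/Γ`, and no `s` is excluded. -/
theorem binCoeff_eq_gamma (s : ℂ) (n : ℕ) :
    binCoeff s n * n.factorial * (Complex.Gamma (s + n))⁻¹ = (Complex.Gamma s)⁻¹ := by
  induction n with
  | zero => simp [binCoeff]
  | succ n ih =>
    have h2 : (n + 1 : ℂ) ≠ 0 := by exact_mod_cast n.succ_ne_zero
    rw [← ih, binCoeff_succ, Nat.factorial_succ,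
      Complex.one_div_Gamma_eq_self_mul_one_div_Gamma_add_one (s + n)]
    push_cast
    rw [add_assoc]
    field_simp

theorem binCoeff_neg_natCast {N n : ℕ} (h : N < n) : binCoeff (-(N : ℂ)) n = 0 :=
  Finset.prod_eq_zero (Finset.mem_range.mpr h) (by simp)

/-- Euler's limit for `Γ(s)`: the coefficient is `n^s / ((s+n) GammaSeq s n)`. At `s = 0, -1, …`,
where this breaks down, the coefficients vanish eventually. -/
theorem binCoeff_isBigO (s : ℂ) :
    (fun n : ℕ => binCoeff s n) =O[atTop] fun n : ℕ => (n : ℝ) ^ (s.re - 1) := by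
  by_cases hs : ∃ m : ℕ, s = -m
  · obtain ⟨N, rfl⟩ := hs
    refine IsBigO.congr' (isBigO_zero _ _) ?_ EventuallyEq.rfl
    filter_upwards [eventually_gt_atTop N] with n hn
    exact (binCoeff_neg_natCast hn).symm
  · have hG : Complex.Gamma s ≠ 0 := fun h => hs ((Complex.Gamma_eq_zero_iff s).mp h)
    have hs' : ∀ k : ℕ, s + k ≠ 0 := fun k h => hs ⟨k, eq_neg_of_add_eq_zero_left h⟩
    have hinv : Tendsto (fun n => (Complex.GammaSeq s n)⁻¹) atTop (𝓝 (Complex.Gamma s)⁻¹) :=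
      (Complex.GammaSeq_tendsto_Gamma s).inv₀ hG
    have heq : ∀ᶠ n : ℕ in atTop, (n : ℂ) ^ s * (s + n)⁻¹ * (Complex.GammaSeq s n)⁻¹ =
        binCoeff s n := by
      filter_upwards [eventually_gt_atTop 0] with n hn
      have h1 : (n : ℂ) ^ s ≠ 0 := by
        rw [Complex.cpow_ne_zero_iff]
        left
        exact_mod_cast hn.ne'
      have h2 : (n.factorial : ℂ) ≠ 0 := by exact_mod_cast n.factorial_ne_zero
      have h3 : binCoeff s n = (∏ k ∈ Finset.range n, (s + k)) / n.factorial := by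
        unfold binCoeff
        rw [Finset.prod_div_distrib, ← Finset.prod_range_add_one_eq_factorial]
        push_cast
        rfl
      have h4 := hs' n
      rw [Complex.GammaSeq, Finset.prod_range_succ, h3]
      field_simp
    refine IsBigO.congr' ?_ heq EventuallyEq.rfl
    have h1 : (fun n : ℕ => (n : ℂ) ^ s) =O[atTop] fun n : ℕ => (n : ℝ) ^ s.re := by
      refine IsBigO.of_bound 1 ?_
      filter_upwards [eventually_gt_atTop 0] with n hn
      rw [Complex.norm_natCast_cpow_of_pos hn, one_mul]
      exact le_abs_self _
    have h2 : (fun n : ℕ => (s + n)⁻¹) =O[atTop] fun n : ℕ => (n : ℝ) ^ (-1 : ℝ) := by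
      refine IsBigO.of_bound 2 ?_
      filter_upwards [eventually_ge_atTop (⌈2 * ‖s‖⌉₊ + 1)] with n hn
      have hn1 : 2 * ‖s‖ + 1 ≤ n := by
        have := Nat.le_ceil (2 * ‖s‖)
        have h' : ((⌈2 * ‖s‖⌉₊ + 1 : ℕ) : ℝ) ≤ n := by exact_mod_cast hn
        push_cast at h'
        linarith
      have hpos : (0 : ℝ) < n := by linarith [norm_nonneg s]
      have h3 : (n : ℝ) / 2 ≤ ‖s + n‖ := by
        have := norm_sub_le (s + n) s
        rw [add_sub_cancel_left, Complex.norm_natCast] at this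
        linarith
      rw [norm_inv, Real.rpow_neg_one, norm_inv, Real.norm_natCast]
      calc ‖s + n‖⁻¹ ≤ ((n : ℝ) / 2)⁻¹ := inv_anti₀ (by positivity) h3
        _ = 2 * (n : ℝ)⁻¹ := by field_simp
    refine ((h1.mul h2).mul (hinv.isBigO_one ℝ)).congr' EventuallyEq.rfl ?_
    filter_upwards [eventually_gt_atTop 0] with n hn
    have hpos : (0 : ℝ) < n := by exact_mod_cast hn
    rw [mul_one, ← Real.rpow_add hpos]
    ring_nf

/-! ### Watson's lemma -/

open MeasureTheory Set in
-- On `(0,δ)` the integrand is bounded by a multiple of `t^a e^(-nt)`, whose integral over the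
-- half-line is `Γ(a+1) n^(-a-1)`. Beyond `δ`, `e^(-nt) ≤ e^(-(n-n₀)δ) e^(-n₀t)`, which is
-- exponentially small in `n`. The sum of both bounds dominates everywhere, so the integral need not
-- be split.
theorem laplace_isBigO {φ : ℝ → ℂ} {n₀ a : ℝ}
    (hint : IntegrableOn (fun t => φ t * Real.exp (-(n₀ * t))) (Ioi 0)) (ha : -1 < a)
    (hφ : φ =O[𝓝[>] 0] fun t => t ^ a) :
    (fun n : ℕ => ∫ t in Ioi (0 : ℝ), φ t * Real.exp (-(n * t))) =O[atTop]
      fun n : ℕ => (n : ℝ) ^ (-a - 1) := by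
  obtain ⟨C, hC⟩ := hφ.bound
  obtain ⟨δ, hδ, hb⟩ := mem_nhdsGT_iff_exists_Ioo_subset.mp hC
  have hδ0 : (0 : ℝ) < δ := hδ
  set K : ℝ := ∫ t in Ioi (0 : ℝ), ‖φ t * Real.exp (-(n₀ * t))‖ with hK
  have hmain : (fun n : ℕ => |C| * ((1 / (n : ℝ)) ^ (a + 1) * Real.Gamma (a + 1)) +
      Real.exp (n₀ * δ) * K * Real.exp (-δ * n)) =O[atTop] fun n : ℕ => (n : ℝ) ^ (-a - 1) := by
    refine IsBigO.add ?_ ?_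
    · refine IsBigO.const_mul_left ?_ _
      refine IsBigO.of_bound |Real.Gamma (a + 1)| (Eventually.of_forall fun n => ?_)
      rw [norm_mul, one_div, Real.inv_rpow n.cast_nonneg, ← Real.rpow_neg n.cast_nonneg, mul_comm,
        show -(a + 1) = -a - 1 by ring]
      exact le_rfl
    · exact (((isLittleO_exp_neg_mul_rpow_atTop hδ0 (-a - 1)).isBigO).natCast_atTop).const_mul_left _
  refine IsBigO.trans (IsBigO.of_bound 1 ?_) hmain
  filter_upwards [eventually_ge_atTop (⌈n₀⌉₊ + 1)] with n hn
  have hn0 : n₀ ≤ n := (Nat.le_ceil n₀).trans (by exact_mod_cast (by omega : ⌈n₀⌉₊ ≤ n))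
  have hn1 : (0 : ℝ) < n := by exact_mod_cast (by omega : 0 < n)
  have hI1 : IntegrableOn (fun t : ℝ => |C| * (t ^ (a + 1 - 1) * Real.exp (-(n * t)))) (Ioi 0) := by
    refine Integrable.const_mul ?_ _
    have := integrableOn_rpow_mul_exp_neg_mul_rpow (p := 1) (s := a) (b := n) ha one_pos hn1
    simpa [neg_mul, IntegrableOn] using this
  have hI2 : IntegrableOn (fun t : ℝ => Real.exp (n₀ * δ) * Real.exp (-δ * n) *
      ‖φ t * Real.exp (-(n₀ * t))‖) (Ioi 0) := hint.norm.const_mul _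
  have hle := norm_integral_le_of_norm_le (f := fun t => φ t * Real.exp (-(n * t)))
    (hI1.add hI2) ((ae_restrict_iff' measurableSet_Ioi).mpr (Eventually.of_forall fun t ht => ?_))
  · rw [one_mul]
    refine hle.trans ((le_of_eq ?_).trans (le_abs_self _))
    simp only [Pi.add_apply]
    rw [integral_add hI1 hI2, integral_const_mul, integral_const_mul,
      Real.integral_rpow_mul_exp_neg_mul_Ioi (by linarith) hn1]
    ring
  · have ht0 : (0 : ℝ) < t := ht
    simp only [Pi.add_apply, add_sub_cancel_right]
    have e1 : ∀ x : ℝ, ‖((Real.exp x : ℝ) : ℂ)‖ = Real.exp x := fun x => by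
      rw [Complex.norm_real, Real.norm_of_nonneg (Real.exp_pos _).le]
    rw [norm_mul, norm_mul, e1, e1]
    rcases lt_or_ge t δ with h | h
    · have h1 : ‖φ t‖ ≤ |C| * t ^ a := by
        have := hb ⟨ht0, h⟩
        simp only [mem_ofPred_eq] at this
        rw [Real.norm_of_nonneg (Real.rpow_nonneg ht0.le _)] at this
        exact this.trans (mul_le_mul_of_nonneg_right (le_abs_self _) (Real.rpow_nonneg ht0.le _))
      have h2 : ‖φ t‖ * Real.exp (-(n * t)) ≤ |C| * t ^ a * Real.exp (-(n * t)) :=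
        mul_le_mul_of_nonneg_right h1 (Real.exp_pos _).le
      have h3 : 0 ≤ Real.exp (n₀ * δ) * Real.exp (-δ * n) * (‖φ t‖ * Real.exp (-(n₀ * t))) := by
        positivity
      linarith
    · have h1 : 0 ≤ |C| * (t ^ a * Real.exp (-(n * t))) := by positivity
      have h2 : Real.exp (-(n * t)) ≤
          Real.exp (n₀ * δ) * Real.exp (-δ * n) * Real.exp (-(n₀ * t)) := by
        rw [← Real.exp_add, ← Real.exp_add, Real.exp_le_exp]
        nlinarith
      have h3 := mul_le_mul_of_nonneg_left h2 (norm_nonneg (φ t))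
      linarith

/-! ### Laplace integrals -/

open MeasureTheory Set in
-- Substitution `x = e^(-t)`, with `1 - x = x (e^t - 1)`. Convergence is not needed: the change of
-- variables also equates the default values.
theorem integral_exp_sub_one_cpow (σ : ℂ) (n : ℕ) :
    ∫ t in Ioi (0 : ℝ), ((Real.exp t - 1 : ℝ) : ℂ) ^ (-σ) * (Real.exp (-(n * t)) : ℝ) =
      Complex.betaIntegral (n + σ) (1 - σ) := by
  have himg : (fun t : ℝ => Real.exp (-t)) '' Ioi 0 = Ioo 0 1 := by
    ext x
    constructor
    · rintro ⟨t, ht, rfl⟩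
      exact ⟨Real.exp_pos _, by simpa using ht⟩
    · rintro ⟨h0, h1⟩
      exact ⟨-Real.log x, by simpa using Real.log_neg h0 h1, by simp [Real.exp_log h0]⟩
  have hder : ∀ t ∈ Ioi (0 : ℝ),
      HasDerivWithinAt (fun t : ℝ => Real.exp (-t)) (-Real.exp (-t)) (Ioi 0) t := by
    intro t _
    have := ((hasDerivAt_id t).neg.exp).hasDerivWithinAt (s := Ioi (0 : ℝ))
    simpa using this
  have hinj : InjOn (fun t : ℝ => Real.exp (-t)) (Ioi 0) := by
    intro x _ y _ h
    simpa using h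
  rw [Complex.betaIntegral, intervalIntegral.integral_of_le zero_le_one,
    integral_Ioc_eq_integral_Ioo, ← himg,
    integral_image_eq_integral_abs_deriv_smul measurableSet_Ioi hder hinj]
  refine setIntegral_congr_fun measurableSet_Ioi fun t ht => ?_
  have ht0 : (0 : ℝ) < t := ht
  have h0 := Real.exp_pos (-t)
  have hne : ((Real.exp (-t) : ℝ) : ℂ) ≠ 0 := by exact_mod_cast h0.ne'
  have h1 : (0 : ℝ) ≤ Real.exp t - 1 := by linarith [Real.add_one_le_exp t]
  have h2 : (1 : ℂ) - (Real.exp (-t) : ℝ) = (Real.exp (-t) : ℝ) * ((Real.exp t - 1 : ℝ) : ℂ) := by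
    rw [← Complex.ofReal_one, ← Complex.ofReal_sub, ← Complex.ofReal_mul, mul_sub, ← Real.exp_add]
    simp
  have h3 : ((Real.exp (-(n * t)) : ℝ) : ℂ) = ((Real.exp (-t) : ℝ) : ℂ) ^ (n : ℂ) := by
    rw [Complex.cpow_natCast, ← Complex.ofReal_pow, ← Real.exp_nat_mul]
    congr 2
    ring
  rw [abs_neg, abs_of_pos h0, h2, Complex.mul_cpow_ofReal_nonneg h0.le h1, h3, Complex.real_smul,
    show (n + σ - 1 : ℂ) = n + σ + (-1) by ring, Complex.cpow_add _ _ hne, Complex.cpow_add _ _ hne,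
    show (1 - σ - 1 : ℂ) = -σ by ring, Complex.cpow_neg_one]
  simp only [Complex.cpow_neg _ σ]
  have h4 : ((Real.exp (-t) : ℝ) : ℂ) ^ σ ≠ 0 := by
    rw [Complex.cpow_ne_zero_iff]
    exact Or.inl hne
  field_simp

/-! ### The expansion of `(n-θ)^(s-1) / Γ(s)` in binomial coefficients -/

theorem ngFactor_sub_isBigO (s : ℂ) (θ : ℝ) (p : ℕ) :
    (fun ξ : ℂ => ngFactor s θ ξ - ∑ l ∈ Finset.range p, ngCoeff s θ l * (1 - ξ) ^ l)
      =O[𝓝 1] fun ξ => ‖ξ - 1‖ ^ p := by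
  have h := (ngFactor_analyticAt s θ).hasFPowerSeriesAt.isBigO_sub_partialSum_pow p
  have ht : Tendsto (fun ξ : ℂ => ξ - 1) (𝓝 1) (𝓝 0) := by
    have : ContinuousAt (fun ξ : ℂ => ξ - 1) 1 := by fun_prop
    simpa [ContinuousAt] using this
  refine (h.comp_tendsto ht).congr_left fun ξ => ?_
  simp only [Function.comp_apply, add_sub_cancel]
  congr 1
  rw [FormalMultilinearSeries.partialSum]
  refine Finset.sum_congr rfl fun l _ => ?_
  rw [FormalMultilinearSeries.ofScalars_apply_eq, smul_eq_mul, ngCoeff,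
    show (1 : ℂ) - ξ = (-1) * (ξ - 1) by ring, mul_pow]
  have : ((-1 : ℂ) ^ l) * (-1) ^ l = 1 := by rw [← mul_pow]; simp
  linear_combination -(iteratedDeriv l (ngFactor s θ) 1 / (l.factorial : ℂ) * (ξ - 1) ^ l) * this

/-- The function whose Laplace transform is the error of the expansion of
`(n-θ)^(s-1)` in binomial coefficients. -/
noncomputable def ngKernel (s : ℂ) (θ : ℝ) (p : ℕ) (t : ℝ) : ℂ :=
  (t : ℂ) ^ (-s) * (Real.exp (θ * t) : ℝ) - ∑ l ∈ Finset.range p,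
    ngCoeff s θ l * (-1) ^ l * ((Real.exp t - 1 : ℝ) : ℂ) ^ (-(s - l))

/-- At `ξ = e^t` the quotient `-ln ξ/(1-ξ)` is `t/(e^t-1)`, so the kernel is `(e^t-1)^(-s)` times a
Taylor remainder at `ξ = 1`. The signs `(-1)^l` come from `1-ξ = -(e^t-1)`. -/
theorem ngKernel_eq (s : ℂ) (θ : ℝ) (p : ℕ) {t : ℝ} (ht : 0 < t) :
    ngKernel s θ p t = ((Real.exp t - 1 : ℝ) : ℂ) ^ (-s) *
      (ngFactor s θ (Real.exp t : ℝ) -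
        ∑ l ∈ Finset.range p, ngCoeff s θ l * (1 - (Real.exp t : ℝ)) ^ l) := by
  have h1 : 0 < Real.exp t - 1 := by linarith [Real.add_one_lt_exp ht.ne']
  have hne : ((Real.exp t - 1 : ℝ) : ℂ) ≠ 0 := by exact_mod_cast h1.ne'
  have hexp : ((Real.exp t : ℝ) : ℂ) ≠ 1 := by
    intro h
    apply hne
    push_cast at h ⊢
    rw [h, sub_self]
  rw [ngKernel, mul_sub, Finset.mul_sum]
  congr 1
  · rw [ngFactor, if_neg hexp, ← Complex.ofReal_log (Real.exp_pos t).le, Real.log_exp]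
    have h2 : -(t : ℂ) / (1 - (Real.exp t : ℝ)) = (t : ℂ) / ((Real.exp t - 1 : ℝ) : ℂ) := by
      rw [← neg_div_neg_eq]
      push_cast
      ring
    have h3 : ((Real.exp t : ℝ) : ℂ) ^ (θ : ℂ) = (Real.exp (θ * t) : ℝ) := by
      rw [← Complex.ofReal_cpow (Real.exp_pos t).le, ← Real.exp_mul, mul_comm]
    rw [h2, h3, Complex.div_cpow_ofReal_nonneg ht.le h1.le]
    have h4 : ((Real.exp t - 1 : ℝ) : ℂ) ^ (-s) ≠ 0 := by
      rw [Complex.cpow_ne_zero_iff]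
      exact Or.inl hne
    field_simp
  · refine Finset.sum_congr rfl fun l _ => ?_
    rw [show -(s - l) = -s + l by ring, Complex.cpow_add _ _ hne, Complex.cpow_natCast,
      show (1 : ℂ) - (Real.exp t : ℝ) = (-1) * ((Real.exp t - 1 : ℝ) : ℂ) by push_cast; ring,
      mul_pow]
    ring

theorem ngKernel_isBigO {s : ℂ} (hs : s.re < 1) (θ : ℝ) {p : ℕ} (hp : 1 ≤ p) :
    ngKernel s θ p =O[𝓝[>] 0] fun t : ℝ => t ^ ((p : ℝ) - s.re) := by
  have ht : Tendsto (fun t : ℝ => ((Real.exp t : ℝ) : ℂ)) (𝓝[>] 0) (𝓝 1) := by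
    have : ContinuousAt (fun t : ℝ => ((Real.exp t : ℝ) : ℂ)) 0 := by fun_prop
    have h := this.tendsto
    simp only [Real.exp_zero, Complex.ofReal_one] at h
    exact h.mono_left nhdsWithin_le_nhds
  obtain ⟨C, hC⟩ := ((ngFactor_sub_isBigO s θ p).comp_tendsto ht).bound
  have hpr : (1 : ℝ) ≤ p := by exact_mod_cast hp
  -- The power of `2` comes from `e^t - 1 ≤ 2t` for `0 < t < 1`; the exponent is positive since `Re
  -- s < 1 ≤ p`.
  refine IsBigO.of_bound (|C| * 2 ^ ((p : ℝ) - s.re)) ?_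
  have h1 : ∀ᶠ t : ℝ in 𝓝[>] 0, t < 1 :=
    nhdsWithin_le_nhds (gt_mem_nhds one_pos)
  filter_upwards [hC, h1, self_mem_nhdsWithin] with t hb ht1 ht0
  have ht0 : 0 < t := ht0
  have h1 : 0 < Real.exp t - 1 := by linarith [Real.add_one_lt_exp ht0.ne']
  have h2 : Real.exp t - 1 ≤ 2 * t := by
    have := Real.abs_exp_sub_one_le (x := t) (by rw [abs_of_pos ht0]; exact ht1.le)
    rwa [abs_of_pos h1, abs_of_pos ht0] at this
  have h3 : ‖((Real.exp t : ℝ) : ℂ) - 1‖ = Real.exp t - 1 := by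
    rw [← Complex.ofReal_one, ← Complex.ofReal_sub, Complex.norm_real, Real.norm_of_nonneg h1.le]
  simp only [Function.comp_apply] at hb
  rw [h3, Real.norm_of_nonneg (by positivity)] at hb
  rw [ngKernel_eq s θ p ht0, norm_mul, Complex.norm_cpow_eq_rpow_re_of_pos h1,
    Real.norm_of_nonneg (by positivity)]
  calc (Real.exp t - 1) ^ (-s).re * _
      ≤ (Real.exp t - 1) ^ (-s).re * (|C| * (Real.exp t - 1) ^ p) := by
        refine mul_le_mul_of_nonneg_left (hb.trans ?_) (by positivity)
        exact mul_le_mul_of_nonneg_right (le_abs_self _) (by positivity)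
    _ = |C| * (Real.exp t - 1) ^ ((p : ℝ) - s.re) := by
        rw [show (p : ℝ) - s.re = (-s).re + p by rw [Complex.neg_re]; ring, Real.rpow_add h1,
          Real.rpow_natCast]
        ring
    _ ≤ |C| * (2 * t) ^ ((p : ℝ) - s.re) := by
        refine mul_le_mul_of_nonneg_left ?_ (abs_nonneg _)
        exact Real.rpow_le_rpow h1.le h2 (by linarith)
    _ = |C| * 2 ^ ((p : ℝ) - s.re) * t ^ ((p : ℝ) - s.re) := by
        rw [Real.mul_rpow two_pos.le ht0.le]
        ring

theorem inv_Gamma_sub_natCast (s : ℂ) (l : ℕ) :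
    (Complex.Gamma s)⁻¹ * (∏ k ∈ Finset.range l, (1 - s + k)) =
      (-1) ^ l * (Complex.Gamma (s - l))⁻¹ := by
  induction l with
  | zero => simp
  | succ l ih =>
    rw [Finset.prod_range_succ, ← mul_assoc, ih,
      Complex.one_div_Gamma_eq_self_mul_one_div_Gamma_add_one (s - (l + 1 : ℕ))]
    push_cast
    rw [show s - (l + 1 : ℂ) + 1 = s - l by ring, pow_succ]
    ring

theorem Gamma_add_natCast {z : ℂ} (hz : ∀ k : ℕ, z ≠ -(k : ℂ)) (l : ℕ) :
    Complex.Gamma (z + l) = (∏ k ∈ Finset.range l, (z + k)) * Complex.Gamma z := by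
  induction l with
  | zero => simp
  | succ l ih =>
    rw [Finset.prod_range_succ]
    push_cast
    rw [← add_assoc, Complex.Gamma_add_one _ fun h => hz l (eq_neg_of_add_eq_zero_left h), ih]
    ring

/-- The Beta integral is `Γ(n+s-l) Γ(1-s+l) / n!`. The factor `1/(Γ(s)Γ(1-s))` does not depend on
`l`, so a single normalization serves the whole sum. -/
theorem betaIntegral_binCoeff {s : ℂ} (hs : s.re < 1) (l : ℕ) {n : ℕ} (hn : (l : ℝ) - s.re < n) :
    (Complex.Gamma s)⁻¹ * (Complex.Gamma (1 - s))⁻¹ *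
      Complex.betaIntegral (n + (s - l)) (1 - (s - l)) = (-1) ^ l * binCoeff (s - l) n := by
  have h1 : 0 < ((n : ℂ) + (s - l)).re := by
    simp only [Complex.add_re, Complex.sub_re, Complex.natCast_re]
    linarith
  have hl : (0 : ℝ) ≤ l := l.cast_nonneg
  have h0 : 0 < (1 - s).re := by
    simp only [Complex.sub_re, Complex.one_re]
    linarith
  have h2 : 0 < (1 - (s - l)).re := by
    simp only [Complex.sub_re, Complex.one_re, Complex.natCast_re]
    linarith
  have hne0 : ∀ k : ℕ, 1 - s ≠ -(k : ℂ) := by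
    intro k hk
    rw [hk, Complex.neg_re, Complex.natCast_re] at h0
    linarith [(k.cast_nonneg : (0 : ℝ) ≤ k)]
  have hB := Complex.Gamma_mul_Gamma_eq_betaIntegral h1 h2
  rw [show (n : ℂ) + (s - l) + (1 - (s - l)) = n + 1 by ring, Complex.Gamma_nat_eq_factorial,
    show (1 : ℂ) - (s - l) = 1 - s + l by ring, Gamma_add_natCast hne0] at hB
  have hb := binCoeff_eq_gamma (s - l) n
  have hi := inv_Gamma_sub_natCast s l
  have hG0 := Complex.Gamma_ne_zero_of_re_pos h0
  have hG1 := Complex.Gamma_ne_zero_of_re_pos h1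
  have hf : (n.factorial : ℂ) ≠ 0 := by exact_mod_cast n.factorial_ne_zero
  rw [← hb, add_comm (s - l : ℂ)] at hi
  rw [show (1 : ℂ) - (s - l) = 1 - s + l by ring]
  have hB' : Complex.betaIntegral (n + (s - l)) (1 - s + l) =
      Complex.Gamma (n + (s - l)) * ((∏ k ∈ Finset.range l, (1 - s + k)) *
        Complex.Gamma (1 - s)) / n.factorial := by
    rw [hB, mul_div_cancel_left₀ _ hf]
  rw [hB']
  calc _ = ((Complex.Gamma s)⁻¹ * ∏ k ∈ Finset.range l, (1 - s + k)) *
        Complex.Gamma (n + (s - l)) / n.factorial := by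
        field_simp
    _ = _ := by
        rw [hi]
        field_simp

/-- The integral of a non-integrable function is `0` by convention, so an explicit nonzero value
proves integrability. -/
theorem integrableOn_of_integral_ne_zero {f : ℝ → ℂ} {S : Set ℝ} (h : ∫ t in S, f t ≠ 0) :
    MeasureTheory.IntegrableOn f S := by
  by_contra hc
  exact h (MeasureTheory.integral_undef hc)

theorem integral_cpow_neg_mul_exp {s : ℂ} (hs : s.re < 1) {θ r : ℝ} (hr : θ < r) :
    ∫ t in Set.Ioi (0 : ℝ), (t : ℂ) ^ (-s) * (Real.exp (θ * t) : ℝ) * (Real.exp (-(r * t)) : ℝ) =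
      ((r - θ : ℝ) : ℂ) ^ (s - 1) * Complex.Gamma (1 - s) := by
  have h := Complex.integral_cpow_mul_exp_neg_mul_Ioi (a := 1 - s) (r := r - θ)
    (by simpa using hs) (by linarith)
  have hpos : 0 < r - θ := by linarith
  have h2 : (1 / ((r - θ : ℝ) : ℂ)) ^ (1 - s) = ((r - θ : ℝ) : ℂ) ^ (s - 1) := by
    rw [one_div, Complex.inv_cpow, ← Complex.cpow_neg, neg_sub]
    rw [Complex.arg_ofReal_of_nonneg hpos.le]
    exact Real.pi_pos.ne
  rw [← h2, ← h]
  refine MeasureTheory.setIntegral_congr_fun measurableSet_Ioi fun t _ => ?_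
  rw [mul_assoc, ← Complex.ofReal_mul, ← Real.exp_add, Complex.ofReal_exp]
  congr 2
  · ring
  · push_cast
    ring_nf

theorem integrableOn_cpow_neg_mul_exp {s : ℂ} (hs : s.re < 1) {θ r : ℝ} (hr : θ < r) :
    MeasureTheory.IntegrableOn (fun t : ℝ => (t : ℂ) ^ (-s) * (Real.exp (θ * t) : ℝ) *
      (Real.exp (-(r * t)) : ℝ)) (Set.Ioi 0) := by
  apply integrableOn_of_integral_ne_zero
  rw [integral_cpow_neg_mul_exp hs hr]
  refine mul_ne_zero ?_ (Complex.Gamma_ne_zero_of_re_pos (by simpa using hs))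
  rw [Complex.cpow_ne_zero_iff]
  left
  have : r - θ ≠ 0 := (sub_pos.mpr hr).ne'
  exact_mod_cast this

theorem integrableOn_exp_sub_one_cpow {σ : ℂ} (hσ : σ.re < 1) {n : ℕ} (hn : -σ.re < n) :
    MeasureTheory.IntegrableOn (fun t : ℝ => ((Real.exp t - 1 : ℝ) : ℂ) ^ (-σ) *
      (Real.exp (-(n * t)) : ℝ)) (Set.Ioi 0) := by
  apply integrableOn_of_integral_ne_zero
  rw [integral_exp_sub_one_cpow]
  have h1 : 0 < ((n : ℂ) + σ).re := by
    simp only [Complex.add_re, Complex.natCast_re]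
    linarith
  have h2 : 0 < (1 - σ).re := by simpa using hσ
  intro h
  have := Complex.Gamma_mul_Gamma_eq_betaIntegral h1 h2
  rw [h, mul_zero] at this
  exact mul_ne_zero (Complex.Gamma_ne_zero_of_re_pos h1) (Complex.Gamma_ne_zero_of_re_pos h2) this

/-- The remainder of the expansion of `(n-θ)^(s-1) / Γ(s)` in binomial coefficients. -/
noncomputable def expansionError (s : ℂ) (θ : ℝ) (p n : ℕ) : ℂ :=
  ((n - θ : ℝ) : ℂ) ^ (s - 1) * (Complex.Gamma s)⁻¹ -
    ∑ l ∈ Finset.range p, ngCoeff s θ l * binCoeff (s - l) n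

theorem ngKernel_mul_exp (s : ℂ) (θ : ℝ) (p n : ℕ) (t : ℝ) :
    ngKernel s θ p t * (Real.exp (-(n * t)) : ℝ) =
      (t : ℂ) ^ (-s) * (Real.exp (θ * t) : ℝ) * (Real.exp (-(n * t)) : ℝ) -
      ∑ l ∈ Finset.range p, ngCoeff s θ l * (-1) ^ l *
        (((Real.exp t - 1 : ℝ) : ℂ) ^ (-(s - l)) * (Real.exp (-(n * t)) : ℝ)) := by
  rw [ngKernel, sub_mul, Finset.sum_mul]
  congr 1
  exact Finset.sum_congr rfl fun l _ => by ring

theorem re_sub_natCast_lt {s : ℂ} (hs : s.re < 1) (l : ℕ) : (s - l : ℂ).re < 1 := by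
  simp only [Complex.sub_re, Complex.natCast_re]
  have : (0 : ℝ) ≤ l := l.cast_nonneg
  linarith

theorem neg_re_sub_natCast_lt {s : ℂ} {p l n : ℕ} (hl : l ∈ Finset.range p)
    (hn : (p : ℝ) - s.re < n) : -(s - l : ℂ).re < n := by
  simp only [Complex.sub_re, Complex.natCast_re]
  have : (l : ℝ) ≤ p := by exact_mod_cast (Finset.mem_range.mp hl).le
  linarith

theorem integrableOn_ngKernel {s : ℂ} (hs : s.re < 1) {θ : ℝ} {p n : ℕ} (hθ : θ < n)
    (hn : (p : ℝ) - s.re < n) :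
    MeasureTheory.IntegrableOn (fun t : ℝ => ngKernel s θ p t * (Real.exp (-(n * t)) : ℝ))
      (Set.Ioi 0) := by
  simp only [ngKernel_mul_exp]
  refine MeasureTheory.Integrable.sub (integrableOn_cpow_neg_mul_exp hs hθ) ?_
  refine MeasureTheory.integrable_finsetSum _ fun l hl => ?_
  exact (integrableOn_exp_sub_one_cpow (re_sub_natCast_lt hs l)
    (neg_re_sub_natCast_lt hl hn)).const_mul _

theorem integral_ngKernel {s : ℂ} (hs : s.re < 1) {θ : ℝ} {p n : ℕ} (hθ : θ < n)
    (hn : (p : ℝ) - s.re < n) :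
    (Complex.Gamma s)⁻¹ * (Complex.Gamma (1 - s))⁻¹ *
      (∫ t in Set.Ioi (0 : ℝ), ngKernel s θ p t * (Real.exp (-(n * t)) : ℝ)) =
    expansionError s θ p n := by
  have hG : Complex.Gamma (1 - s) ≠ 0 := Complex.Gamma_ne_zero_of_re_pos (by simpa using hs)
  have hI : ∀ l ∈ Finset.range p, MeasureTheory.IntegrableOn (fun t : ℝ =>
      ngCoeff s θ l * (-1) ^ l *
        (((Real.exp t - 1 : ℝ) : ℂ) ^ (-(s - l)) * (Real.exp (-(n * t)) : ℝ))) (Set.Ioi 0) :=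
    fun l hl => (integrableOn_exp_sub_one_cpow (re_sub_natCast_lt hs l)
      (neg_re_sub_natCast_lt hl hn)).const_mul _
  simp only [ngKernel_mul_exp]
  rw [MeasureTheory.integral_sub (integrableOn_cpow_neg_mul_exp hs hθ)
    (MeasureTheory.integrable_finsetSum _ hI), MeasureTheory.integral_finsetSum _ hI,
    integral_cpow_neg_mul_exp hs hθ, mul_sub, expansionError, Finset.mul_sum]
  congr 1
  · field_simp
  · refine Finset.sum_congr rfl fun l hl => ?_
    have hn' : (l : ℝ) - s.re < n := by
      have := neg_re_sub_natCast_lt hl hn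
      simp only [Complex.sub_re, Complex.natCast_re] at this
      linarith
    rw [MeasureTheory.integral_const_mul, integral_exp_sub_one_cpow]
    have h1 : ((-1 : ℂ) ^ l) * (-1) ^ l = 1 := by rw [← mul_pow]; simp
    have h2 := betaIntegral_binCoeff hs l hn'
    linear_combination ngCoeff s θ l * (-1) ^ l * h2 + ngCoeff s θ l * binCoeff (s - l) n * h1

theorem expansionError_isBigO_of_re_lt_one {s : ℂ} (hs : s.re < 1) (θ : ℝ) {p : ℕ} (hp : 1 ≤ p) :
    (fun n : ℕ => expansionError s θ p n) =O[atTop] fun n : ℕ => (n : ℝ) ^ (s.re - 1 - p) := by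
  have hpr : (1 : ℝ) ≤ p := by exact_mod_cast hp
  -- Beyond `θ` the Gamma integral converges at infinity; beyond `p - Re s` all the Beta integrals
  -- do.
  obtain ⟨n₀, hn₀⟩ := exists_nat_gt (max θ (p - s.re))
  have h1 : θ < n₀ := (le_max_left _ _).trans_lt hn₀
  have h2 : (p : ℝ) - s.re < n₀ := (le_max_right _ _).trans_lt hn₀
  have hW := laplace_isBigO (integrableOn_ngKernel hs h1 h2) (by linarith)
    (ngKernel_isBigO hs θ hp)
  rw [show -((p : ℝ) - s.re) - 1 = s.re - 1 - p by ring] at hW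
  refine (hW.const_mul_left ((Complex.Gamma s)⁻¹ * (Complex.Gamma (1 - s))⁻¹)).congr' ?_
    EventuallyEq.rfl
  filter_upwards [eventually_ge_atTop n₀] with n hn
  have hn' : (n₀ : ℝ) ≤ n := by exact_mod_cast hn
  exact integral_ngKernel hs (h1.trans_le hn') (h2.trans_le hn')

/-- Multiplication by `n-θ` raises the order by one, through the recursions for `γ_l` and for the
binomial coefficients. Truncation leaves one boundary term. -/
theorem sum_ngCoeff_succ (s : ℂ) (θ : ℝ) (p n : ℕ) :
    s * ∑ l ∈ Finset.range (p + 1), ngCoeff (s + 1) θ l * binCoeff (s + 1 - l) n =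
      (n - θ) * (∑ l ∈ Finset.range (p + 1), ngCoeff s θ l * binCoeff (s - l) n) +
        (s - p + θ) * ngCoeff s θ p * binCoeff (s - p) n := by
  induction p with
  | zero =>
    simp only [zero_add, Finset.range_one, Finset.sum_singleton, ngCoeff_zero, Nat.cast_zero,
      sub_zero]
    linear_combination -natCast_mul_binCoeff s n
  | succ p ih =>
    rw [Finset.sum_range_succ, mul_add, ih, Finset.sum_range_succ _ (p + 1)]
    have h1 := ngCoeff_succ_right s θ p
    have h2 := natCast_mul_binCoeff (s - (p + 1)) n
    rw [show s - (p + 1 : ℂ) + 1 = s - p by ring] at h2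
    push_cast
    rw [show s + 1 - (p + 1 : ℂ) = s - p by ring]
    linear_combination binCoeff (s - p) n * h1 - ngCoeff s θ (p + 1) * h2

/-- The boundary term has the size `n^(Re s-p-1)` allowed for the new error, so nothing is lost in
the induction. -/
theorem expansionError_succ {s : ℂ} (hs : s ≠ 0) {θ : ℝ} (p : ℕ) {n : ℕ} (hn : θ < n) :
    expansionError (s + 1) θ (p + 1) n = s⁻¹ * ((n - θ) * expansionError s θ (p + 1) n -
      (s - p + θ) * ngCoeff s θ p * binCoeff (s - p) n) := by
  have h := sum_ngCoeff_succ s θ p n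
  have hne : ((n - θ : ℝ) : ℂ) ≠ 0 := by
    have : (n - θ : ℝ) ≠ 0 := (sub_pos.mpr hn).ne'
    exact_mod_cast this
  unfold expansionError
  have h2 : ((n - θ : ℝ) : ℂ) ^ (s + 1 - 1) = ((n - θ : ℝ) : ℂ) ^ (s - 1) * (n - θ) := by
    rw [show s + 1 - 1 = s - 1 + 1 by ring, Complex.cpow_add _ _ hne, Complex.cpow_one]
    push_cast
    rfl
  rw [h2, Complex.Gamma_add_one s hs, mul_inv]
  field_simp
  linear_combination -h

/-- The recursion divides by `s`, so it cannot reach order `1` from order `0`. There the expansion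
is exact for large `n`: every binomial coefficient but the first vanishes. -/
theorem expansionError_one (θ : ℝ) (p : ℕ) :
    (fun n : ℕ => expansionError 1 θ (p + 1) n) =ᶠ[atTop] 0 := by
  filter_upwards [eventually_gt_atTop (p + 1)] with n hn
  have h1 : binCoeff 1 n = 1 := by
    refine Finset.prod_eq_one fun k _ => ?_
    rw [add_comm, div_self]
    exact_mod_cast k.succ_ne_zero
  rw [expansionError, Finset.sum_range_succ', Finset.sum_eq_zero]
  · simp [h1]
  · intro l hl
    have hl' := Finset.mem_range.mp hl
    rw [show (1 : ℂ) - (l + 1 : ℕ) = -(l : ℂ) by push_cast; ring,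
      binCoeff_neg_natCast (by omega), mul_zero]

theorem expansionError_isBigO (s : ℂ) (θ : ℝ) {p : ℕ} (hp : 1 ≤ p) :
    (fun n : ℕ => expansionError s θ p n) =O[atTop] fun n : ℕ => (n : ℝ) ^ (s.re - 1 - p) := by
  obtain ⟨p, rfl⟩ := Nat.exists_eq_add_of_le' hp
  obtain ⟨k, hk⟩ := exists_nat_gt s.re
  induction k generalizing s with
  | zero => exact expansionError_isBigO_of_re_lt_one (by push_cast at hk; linarith) θ hp
  | succ k ih =>
    by_cases hs : s = 1
    · rw [hs]
      exact IsBigO.congr' (isBigO_zero _ _) (expansionError_one θ p).symm EventuallyEq.rfl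
    obtain ⟨z, rfl⟩ : ∃ z, s = z + 1 := ⟨s - 1, by ring⟩
    have hz : z ≠ 0 := fun h => hs (by rw [h, zero_add])
    have hih := ih z (by simp only [Complex.add_re, Complex.one_re] at hk; push_cast at hk; linarith)
    have hlin : (fun n : ℕ => (n : ℂ) - θ) =O[atTop] fun n : ℕ => (n : ℝ) ^ (1 : ℝ) := by
      refine IsBigO.of_bound (1 + |θ|) ?_
      filter_upwards [eventually_ge_atTop 1] with n hn
      have hn1 : (1 : ℝ) ≤ n := by exact_mod_cast hn
      rw [Real.rpow_one, Real.norm_natCast]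
      calc ‖(n : ℂ) - θ‖ ≤ ‖(n : ℂ)‖ + ‖(θ : ℂ)‖ := norm_sub_le _ _
        _ = n + |θ| := by rw [Complex.norm_natCast, Complex.norm_real, Real.norm_eq_abs]
        _ ≤ (1 + |θ|) * n := by nlinarith [abs_nonneg θ]
    have h1 : (fun n : ℕ => ((n : ℂ) - θ) * expansionError z θ (p + 1) n) =O[atTop]
        fun n : ℕ => (n : ℝ) ^ ((z + 1).re - 1 - (p + 1 : ℕ)) := by
      refine (hlin.mul hih).congr' EventuallyEq.rfl ?_
      filter_upwards [eventually_gt_atTop 0] with n hn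
      rw [← Real.rpow_add (by exact_mod_cast hn)]
      congr 1
      simp only [Complex.add_re, Complex.one_re]
      ring
    have h2 : (fun n : ℕ => (z - p + θ) * ngCoeff z θ p * binCoeff (z - p) n) =O[atTop]
        fun n : ℕ => (n : ℝ) ^ ((z + 1).re - 1 - (p + 1 : ℕ)) := by
      refine ((binCoeff_isBigO (z - p)).const_mul_left _).congr_right fun n => ?_
      congr 1
      simp only [Complex.sub_re, Complex.natCast_re, Complex.add_re, Complex.one_re]
      push_cast
      ring
    refine ((h1.sub h2).const_mul_left z⁻¹).congr' ?_ EventuallyEq.rfl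
    obtain ⟨N, hN⟩ := exists_nat_gt θ
    filter_upwards [eventually_ge_atTop N] with n hn
    exact (expansionError_succ hz p (hN.trans_le (by exact_mod_cast hn))).symm

/-! ### The Riemann-Liouville operator on powers -/

theorem rlIntegral_power_of_re_pos {α β : ℂ} (hα : 0 < α.re) (hβ : 0 < β.re) {x : ℝ} (hx : 0 < x) :
    rlIntegral α (power β) x =
      Complex.Gamma β * (Complex.Gamma (α + β))⁻¹ * (x : ℂ) ^ (α + β - 1) := by
  have hα0 : α ≠ 0 := by
    rintro rfl
    simp at hα
  have hαβ : 0 < (α + β).re := by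
    simp only [Complex.add_re]
    linarith
  have h := Complex.betaIntegral_scaled β α hx
  have hB := Complex.Gamma_mul_Gamma_eq_betaIntegral hβ hα
  have h1 := Complex.Gamma_ne_zero_of_re_pos hα
  have h2 := Complex.Gamma_ne_zero_of_re_pos hαβ
  have h3 : ∫ s in (0 : ℝ)..x, ((x - s : ℝ) : ℂ) ^ (α - 1) * power β s =
      (x : ℂ) ^ (β + α - 1) * Complex.betaIntegral β α := by
    rw [← h]
    refine intervalIntegral.integral_congr fun s _ => ?_
    simp only [power, Complex.ofReal_sub]
    ring
  rw [rlIntegral, if_neg hα0, h3, add_comm β α]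
  rw [add_comm β α] at hB
  field_simp
  linear_combination -(x : ℂ) ^ (α + β - 1) * hB

theorem rlIntegral_power {α β : ℂ} (hα : α = 0 ∨ 0 < α.re) (hβ : 0 < β.re) {x : ℝ} (hx : 0 < x) :
    rlIntegral α (power β) x =
      Complex.Gamma β * (Complex.Gamma (α + β))⁻¹ * (x : ℂ) ^ (α + β - 1) := by
  rcases hα with rfl | hα
  · rw [rlIntegral, if_pos rfl, zero_add, mul_inv_cancel₀ (Complex.Gamma_ne_zero_of_re_pos hβ),
      one_mul, power]
  · exact rlIntegral_power_of_re_pos hα hβ hx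

/-- Differentiation sends `x^c/Γ(c+1)` to `x^(c-1)/Γ(c)`, also where `1/Γ` vanishes. This serves
both the derivatives in `I^α` and those of the finite part. -/
theorem iteratedDeriv_cpow_div_Gamma (k : ℕ) {g : ℝ → ℂ} {K c : ℂ}
    (hg : ∀ x : ℝ, 0 < x → g x = K * (Complex.Gamma (c + k))⁻¹ * (x : ℂ) ^ (c + k - 1)) :
    ∀ x : ℝ, 0 < x → iteratedDeriv k g x = K * (Complex.Gamma c)⁻¹ * (x : ℂ) ^ (c - 1) := by
  induction k generalizing c with
  | zero => simpa using hg
  | succ k ih =>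
    intro x hx
    have h1 := ih (c := c + 1) fun y hy => by
      rw [hg y hy]
      push_cast
      rw [add_assoc c 1, add_comm (1 : ℂ) k]
    have he : iteratedDeriv k g =ᶠ[𝓝 x]
        fun y : ℝ => K * (Complex.Gamma (c + 1))⁻¹ * (y : ℂ) ^ c := by
      filter_upwards [lt_mem_nhds hx] with y hy
      rw [h1 y hy, add_sub_cancel_right]
    rw [iteratedDeriv_succ, he.deriv_eq]
    have hd : HasDerivAt (fun y : ℝ => (y : ℂ) ^ c) (c * (x : ℂ) ^ (c - 1)) x := by
      have h := ((hasDerivAt_id (x : ℂ)).cpow_const (c := c)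
        (Complex.ofReal_mem_slitPlane.mpr hx)).comp_ofReal
      simpa using h
    rw [(hd.const_mul _).deriv, Complex.one_div_Gamma_eq_self_mul_one_div_Gamma_add_one c]
    ring

theorem rlOrder_spec (α : ℂ) : α + rlOrder α = 0 ∨ 0 < (α + rlOrder α).re := by
  refine Nat.sInf_mem (s := {n : ℕ | α + n = 0 ∨ 0 < (α + n).re}) ?_
  obtain ⟨n, hn⟩ := exists_nat_gt (-α.re)
  refine ⟨n, Or.inr ?_⟩
  simp only [Complex.add_re, Complex.natCast_re]
  linarith

theorem powerOrder_spec (β : ℂ) : 0 < (β + powerOrder β).re := by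
  refine Nat.sInf_mem (s := {m : ℕ | 0 < (β + m).re}) ?_
  obtain ⟨n, hn⟩ := exists_nat_gt (-β.re)
  refine ⟨n, ?_⟩
  change 0 < (β + n).re
  simp only [Complex.add_re, Complex.natCast_re]
  linarith

theorem rl_power (α : ℂ) {β : ℂ} (hβ : 0 < β.re) {x : ℝ} (hx : 0 < x) :
    rl α (power β) x = Complex.Gamma β * (Complex.Gamma (α + β))⁻¹ * (x : ℂ) ^ (α + β - 1) := by
  refine iteratedDeriv_cpow_div_Gamma (rlOrder α) (fun y hy => ?_) x hx
  rw [rlIntegral_power (rlOrder_spec α) hβ hy, add_right_comm]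

theorem rlPower_one (α : ℂ) {β : ℂ} (hβ : ∀ k : ℕ, β ≠ -(k : ℂ)) :
    rlPower α β 1 = Complex.Gamma β * (Complex.Gamma (α + β))⁻¹ := by
  have h := iteratedDeriv_cpow_div_Gamma (powerOrder β)
    (g := rl α (power (β + powerOrder β))) (K := Complex.Gamma (β + powerOrder β)) (c := α + β)
    (fun y hy => by rw [rl_power α (powerOrder_spec β) hy, add_assoc]) 1 one_pos
  rw [rlPower, h, Gamma_add_natCast hβ]
  have hne : ∏ i ∈ Finset.range (powerOrder β), (β + i) ≠ 0 :=
    Finset.prod_ne_zero_iff.mpr fun i _ h => hβ i (eq_neg_of_add_eq_zero_left h)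
  simp only [Complex.ofReal_one, Complex.one_cpow, mul_one]
  field_simp

/-! ### Convolutions -/

/-- The convolution of two sequences. -/
noncomputable def conv (u v : ℕ → ℂ) (n : ℕ) : ℂ := ∑ j ∈ Finset.range (n + 1), u j * v (n - j)

theorem rpow_le_two_rpow_mul {x y : ℝ} (hx : 0 < x) (hy : 0 < y) (hxy : x ≤ 2 * y)
    (hyx : y ≤ 2 * x) (a : ℝ) : x ^ a ≤ 2 ^ |a| * y ^ a := by
  rcases le_total 0 a with ha | ha
  · rw [abs_of_nonneg ha, ← Real.mul_rpow two_pos.le hy.le]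
    exact Real.rpow_le_rpow hx.le hxy ha
  · rw [abs_of_nonpos ha, Real.rpow_neg two_pos.le, ← Real.inv_rpow two_pos.le,
      ← Real.mul_rpow (by positivity) hy.le]
    exact Real.rpow_le_rpow_of_nonpos (by positivity) (by linarith) ha

/-- A convolution involves every index, so the bound must hold from `n = 0` on; hence `n + 1`. -/
theorem exists_bound_of_isBigO {u : ℕ → ℂ} {a : ℝ}
    (h : u =O[atTop] fun n : ℕ => (n : ℝ) ^ a) :
    ∃ C : ℝ, 0 ≤ C ∧ ∀ n : ℕ, ‖u n‖ ≤ C * ((n : ℝ) + 1) ^ a := by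
  have h1 : (fun n : ℕ => (n : ℝ) ^ a) =O[atTop] fun n : ℕ => ((n : ℝ) + 1) ^ a := by
    refine IsBigO.of_bound (2 ^ |a|) ?_
    filter_upwards [eventually_ge_atTop 1] with n hn
    have hn1 : (1 : ℝ) ≤ n := by exact_mod_cast hn
    rw [Real.norm_of_nonneg (by positivity), Real.norm_of_nonneg (by positivity)]
    exact rpow_le_two_rpow_mul (by linarith) (by linarith) (by linarith) (by linarith) a
  obtain ⟨C, hC, hb⟩ := bound_of_isBigO_nat_atTop (h.trans h1)
  refine ⟨C, hC.le, fun n => ?_⟩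
  have hpos : (0 : ℝ) < ((n : ℝ) + 1) ^ a := by positivity
  have := hb (x := n) hpos.ne'
  rwa [Real.norm_of_nonneg hpos.le] at this

/-- If `v` decays fast enough, moving the factor `(j+1)^a` to `(n+1)^a` costs only `(n-j+1)^|a|`,
and the sum over `n-j` still converges. -/
theorem conv_isBigO {u v : ℕ → ℂ} {a b : ℝ} (hu : u =O[atTop] fun n : ℕ => (n : ℝ) ^ a)
    (hv : v =O[atTop] fun n : ℕ => (n : ℝ) ^ b) (hab : |a| + b < -1) :
    conv u v =O[atTop] fun n : ℕ => ((n : ℝ) + 1) ^ a := by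
  obtain ⟨C, hC0, hC⟩ := exists_bound_of_isBigO hu
  obtain ⟨D, hD0, hD⟩ := exists_bound_of_isBigO hv
  have hsum : Summable fun k : ℕ => ((k : ℝ) + 1) ^ (|a| + b) := by
    have := (summable_nat_add_iff 1).mpr (Real.summable_nat_rpow.mpr hab)
    simpa using this
  refine IsBigO.of_bound (C * D * ∑' k : ℕ, ((k : ℝ) + 1) ^ (|a| + b))
    (Eventually.of_forall fun n => ?_)
  rw [Real.norm_of_nonneg (by positivity)]
  have hterm : ∀ j ∈ Finset.range (n + 1), ‖u j * v (n - j)‖ ≤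
      C * D * ((n : ℝ) + 1) ^ a * (((n - j : ℕ) : ℝ) + 1) ^ (|a| + b) := by
    intro j hj
    have hj' : j ≤ n := Nat.lt_succ_iff.mp (Finset.mem_range.mp hj)
    obtain ⟨k, rfl⟩ := Nat.exists_eq_add_of_le hj'
    rw [Nat.add_sub_cancel_left, norm_mul]
    have hj1 : (0 : ℝ) < (j : ℝ) + 1 := by positivity
    have hk1 : (1 : ℝ) ≤ (k : ℝ) + 1 := by linarith [(k.cast_nonneg : (0 : ℝ) ≤ k)]
    have hk0 : (0 : ℝ) < (k : ℝ) + 1 := by positivity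
    -- For `a ≥ 0` monotonicity suffices; for `a ≤ 0` it is `j+k+1 ≤ (j+1)(k+1)`.
    have hkey : ((j : ℝ) + 1) ^ a ≤ (((j + k : ℕ) : ℝ) + 1) ^ a * ((k : ℝ) + 1) ^ |a| := by
      push_cast
      rcases le_total 0 a with ha | ha
      · calc ((j : ℝ) + 1) ^ a ≤ ((j : ℝ) + k + 1) ^ a :=
              Real.rpow_le_rpow hj1.le (by linarith) ha
          _ ≤ _ := le_mul_of_one_le_right (by positivity) (Real.one_le_rpow hk1 (abs_nonneg _))
      · rw [abs_of_nonpos ha, Real.rpow_neg hk0.le, ← Real.inv_rpow hk0.le,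
          ← Real.mul_rpow (by positivity) (by positivity)]
        refine Real.rpow_le_rpow_of_nonpos (by positivity) ?_ ha
        rw [← div_eq_mul_inv, div_le_iff₀ hk0]
        have : (0 : ℝ) ≤ (j : ℝ) * k := by positivity
        nlinarith
    calc ‖u j‖ * ‖v k‖ ≤ (C * ((j : ℝ) + 1) ^ a) * (D * ((k : ℝ) + 1) ^ b) :=
          mul_le_mul (hC j) (hD k) (norm_nonneg _) (by positivity)
      _ ≤ (C * ((((j + k : ℕ) : ℝ) + 1) ^ a * ((k : ℝ) + 1) ^ |a|)) * (D * ((k : ℝ) + 1) ^ b) := by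
          gcongr
      _ = _ := by
          rw [Real.rpow_add hk0]
          ring
  calc ‖conv u v n‖ ≤ ∑ j ∈ Finset.range (n + 1),
        C * D * ((n : ℝ) + 1) ^ a * (((n - j : ℕ) : ℝ) + 1) ^ (|a| + b) :=
        norm_sum_le_of_le _ hterm
    _ = C * D * ((n : ℝ) + 1) ^ a * ∑ k ∈ Finset.range (n + 1), ((k : ℝ) + 1) ^ (|a| + b) := by
        rw [← Finset.mul_sum]
        congr 1
        have := Finset.sum_range_reflect (fun k : ℕ => ((k : ℝ) + 1) ^ (|a| + b)) (n + 1)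
        simpa using this
    _ ≤ C * D * ((n : ℝ) + 1) ^ a * ∑' k : ℕ, ((k : ℝ) + 1) ^ (|a| + b) := by
        refine mul_le_mul_of_nonneg_left ?_ (by positivity)
        exact hsum.sum_le_tsum _ fun k _ => by positivity
    _ = _ := by ring

/-! ### The quadrature error -/

theorem isBigO_natCast_rpow_of_le {a b : ℝ} (h : a ≤ b) :
    (fun n : ℕ => (n : ℝ) ^ a) =O[atTop] fun n : ℕ => (n : ℝ) ^ b := by
  refine IsBigO.of_bound 1 ?_
  filter_upwards [eventually_ge_atTop 1] with n hn
  have hn1 : (1 : ℝ) ≤ n := by exact_mod_cast hn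
  rw [Real.norm_of_nonneg (by positivity), Real.norm_of_nonneg (by positivity), one_mul]
  exact Real.rpow_le_rpow_of_exponent_le hn1 h

theorem binCoeff_isBigO_of_le {s : ℂ} {a : ℝ} (h : s.re - 1 ≤ a) :
    binCoeff s =O[atTop] fun n : ℕ => (n : ℝ) ^ a :=
  (binCoeff_isBigO s).trans (isBigO_natCast_rpow_of_le h)

theorem weights_ngGen_isBigO (α : ℂ) (θ : ℝ) (p : ℕ) :
    weights (ngGen α θ p) =O[atTop] fun n : ℕ => (n : ℝ) ^ (α.re - 1) := by
  have h : weights (ngGen α θ p) = fun n => ∑ i ∈ Finset.range p,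
      ngCoeff α θ i * binCoeff (α - i) n := funext (weights_ngGen α θ p)
  rw [h]
  refine IsBigO.fun_sum fun i _ => (binCoeff_isBigO_of_le ?_).const_mul_left _
  simp only [Complex.sub_re, Complex.natCast_re]
  linarith [(i.cast_nonneg : (0 : ℝ) ≤ i)]

theorem conv_weights_binCoeff (α : ℂ) (θ : ℝ) (p : ℕ) (s : ℂ) (n : ℕ) :
    conv (weights (ngGen α θ p)) (binCoeff s) n =
      ∑ i ∈ Finset.range p, ngCoeff α θ i * binCoeff (α - i + s) n := by
  simp only [conv, weights_ngGen, Finset.sum_mul]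
  rw [Finset.sum_comm]
  refine Finset.sum_congr rfl fun i _ => ?_
  rw [binCoeff_add, Finset.mul_sum]
  exact Finset.sum_congr rfl fun j _ => by ring

/-- Exact even at `k = 0`: the remainder absorbs the value assigned to `f(0)`. -/
theorem power_natCast_eq {β : ℂ} (hβ : ∀ k : ℕ, β ≠ -(k : ℂ)) (M k : ℕ) :
    power β k = Complex.Gamma β * expansionError β 0 M k +
      ∑ m ∈ Finset.range M, Complex.Gamma β * ngCoeff β 0 m * binCoeff (β - m) k := by
  have hG : Complex.Gamma β ≠ 0 := Complex.Gamma_ne_zero hβ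
  rw [expansionError, power, sub_zero, mul_sub, Finset.mul_sum]
  simp only [mul_assoc, sub_add_cancel]
  field_simp

theorem conv_weights_power {β : ℂ} (hβ : ∀ k : ℕ, β ≠ -(k : ℂ)) (α : ℂ) (θ : ℝ) (p M n : ℕ) :
    conv (weights (ngGen α θ p)) (fun k => power β k) n =
      conv (weights (ngGen α θ p)) (fun k => Complex.Gamma β * expansionError β 0 M k) n +
      Complex.Gamma β * ∑ i ∈ Finset.range p, ∑ m ∈ Finset.range M,
        ngCoeff α θ i * ngCoeff β 0 m * binCoeff (α + β - (i + m : ℕ)) n := by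
  have h1 : ∀ m, conv (weights (ngGen α θ p)) (binCoeff (β - m)) n = _ :=
    fun m => conv_weights_binCoeff α θ p (β - m) n
  have h2 : ∑ m ∈ Finset.range M, Complex.Gamma β * ngCoeff β 0 m *
      conv (weights (ngGen α θ p)) (binCoeff (β - m)) n =
      Complex.Gamma β * ∑ i ∈ Finset.range p, ∑ m ∈ Finset.range M,
        ngCoeff α θ i * ngCoeff β 0 m * binCoeff (α + β - (i + m : ℕ)) n := by
    rw [Finset.sum_comm, Finset.mul_sum]
    refine Finset.sum_congr rfl fun m _ => ?_
    rw [h1, Finset.mul_sum, Finset.mul_sum]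
    refine Finset.sum_congr rfl fun i _ => ?_
    rw [show α - i + (β - m) = α + β - (i + m : ℕ) by push_cast; ring]
    ring
  rw [← h2]
  simp only [conv, Finset.mul_sum]
  rw [Finset.sum_comm, ← Finset.sum_add_distrib]
  refine Finset.sum_congr rfl fun j _ => ?_
  rw [power_natCast_eq hβ M, mul_add, Finset.mul_sum]
  congr 1
  exact Finset.sum_congr rfl fun m _ => by ring

/-- The double sum of `conv_weights_power`, split by total degree. -/
theorem sum_ngCoeff_mul (α β : ℂ) (θ : ℝ) {p M : ℕ} (hM : p ≤ M) (n : ℕ) :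
    ∑ i ∈ Finset.range p, ∑ m ∈ Finset.range M,
        ngCoeff α θ i * ngCoeff β 0 m * binCoeff (α + β - (i + m : ℕ)) n =
      ∑ l ∈ Finset.range p, ngCoeff (α + β) θ l * binCoeff (α + β - l) n +
      ∑ i ∈ Finset.range p, ∑ m ∈ Finset.Ico (p - i) M,
        ngCoeff α θ i * ngCoeff β 0 m * binCoeff (α + β - (i + m : ℕ)) n := by
  have h := Finset.sum_range_diag_flip p fun i m =>
    ngCoeff α θ i * ngCoeff β 0 m * binCoeff (α + β - (i + m : ℕ)) n
  have h2 : ∑ l ∈ Finset.range p, ngCoeff (α + β) θ l * binCoeff (α + β - l) n =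
      ∑ i ∈ Finset.range p, ∑ m ∈ Finset.range (p - i),
        ngCoeff α θ i * ngCoeff β 0 m * binCoeff (α + β - (i + m : ℕ)) n := by
    rw [← h]
    refine Finset.sum_congr rfl fun l _ => ?_
    rw [ngCoeff_add, Finset.sum_mul]
    refine Finset.sum_congr rfl fun i hi => ?_
    rw [Nat.add_sub_cancel' (Nat.lt_succ_iff.mp (Finset.mem_range.mp hi))]
  rw [h2, ← Finset.sum_add_distrib]
  refine Finset.sum_congr rfl fun i _ => ?_
  rw [Finset.sum_range_add_sum_Ico _ ((Nat.sub_le p i).trans hM)]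

theorem mesh_pos {θ : ℝ} {n : ℕ} (h : θ < n) : 0 < mesh θ n :=
  one_div_pos.mpr (sub_pos.mpr h)

/-- The shift cancels in the nodes, which are `(n-j)h`, and `h^(β-1)` factors out. -/
theorem convPart_mesh (α β : ℂ) {θ : ℝ} (ω : ℕ → ℂ) {n : ℕ} (h : θ < n) :
    convPart α θ ω (mesh θ n) (power β) n =
      (mesh θ n : ℂ) ^ (α + β - 1) * conv ω (fun k => power β k) n := by
  have hm := mesh_pos h
  have hne : (mesh θ n : ℂ) ≠ 0 := by exact_mod_cast hm.ne'
  rw [convPart, show α + β - 1 = α + (β - 1) by ring, Complex.cpow_add _ _ hne, mul_assoc, conv,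
    Finset.mul_sum (s := Finset.range (n + 1)) (a := (mesh θ n : ℂ) ^ (β - 1))]
  congr 1
  refine Finset.sum_congr rfl fun j hj => ?_
  have hj' : j ≤ n := Nat.lt_succ_iff.mp (Finset.mem_range.mp hj)
  have e : ((n : ℝ) - θ) * mesh θ n + (θ - j) * mesh θ n = ((n - j : ℕ) : ℝ) * mesh θ n := by
    rw [Nat.cast_sub hj']
    ring
  rw [e, power, power, Complex.ofReal_mul,
    Complex.mul_cpow_ofReal_nonneg (Nat.cast_nonneg _) hm.le]
  ring

/-- Since `h (n-θ) = 1`, the leading term `h^(α+β-1) (n-θ)^(α+β-1) Γ(β)/Γ(α+β)` is exactly the value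
of `I^α t^(β-1)` at `1`; only remainders survive. -/
theorem errorAtOne_eq {β : ℂ} (hβ : ∀ k : ℕ, β ≠ -(k : ℂ)) (α : ℂ) {θ : ℝ} {p M n : ℕ}
    (hM : p ≤ M) (h : θ < n) :
    errorAtOne α θ (weights (ngGen α θ p)) β n =
      (mesh θ n : ℂ) ^ (α + β - 1) *
        (conv (weights (ngGen α θ p)) (fun k => Complex.Gamma β * expansionError β 0 M k) n) +
      (mesh θ n : ℂ) ^ (α + β - 1) * (Complex.Gamma β *
        (∑ i ∈ Finset.range p, ∑ m ∈ Finset.Ico (p - i) M,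
          ngCoeff α θ i * ngCoeff β 0 m * binCoeff (α + β - (i + m : ℕ)) n -
        expansionError (α + β) θ p n)) := by
  have hpos : (0 : ℝ) < n - θ := sub_pos.mpr h
  have h1 : (mesh θ n : ℂ) ^ (α + β - 1) * ((n - θ : ℝ) : ℂ) ^ (α + β - 1) = 1 := by
    rw [← Complex.mul_cpow_ofReal_nonneg (mesh_pos h).le hpos.le, ← Complex.ofReal_mul, mesh,
      one_div_mul_cancel hpos.ne', Complex.ofReal_one, Complex.one_cpow]
  rw [errorAtOne, convPart_mesh α β _ h, rlPower_one α hβ, conv_weights_power hβ α θ p M,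
    sum_ngCoeff_mul α β θ hM]
  have h2 : expansionError (α + β) θ p n =
      ((n - θ : ℝ) : ℂ) ^ (α + β - 1) * (Complex.Gamma (α + β))⁻¹ -
        ∑ l ∈ Finset.range p, ngCoeff (α + β) θ l * binCoeff (α + β - l) n := rfl
  rw [h2]
  linear_combination Complex.Gamma β * (Complex.Gamma (α + β))⁻¹ * h1

theorem eventually_mesh (θ : ℝ) : ∀ᶠ n : ℕ in atTop, θ < n ∧ 0 < n ∧
    ∀ a : ℝ, (n : ℝ) ^ a ≤ 2 ^ |a| * mesh θ n ^ (-a) ∧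
      ((n : ℝ) + 1) ^ a ≤ 2 ^ |a| * mesh θ n ^ (-a) := by
  -- From here on, `n` and `n+1` are both within a factor `2` of `n-θ = 1/h`.
  obtain ⟨N, hN⟩ := exists_nat_gt (2 * |θ| + 1)
  filter_upwards [eventually_ge_atTop N] with n hn
  have hn' : 2 * |θ| + 1 < n := hN.trans_le (by exact_mod_cast hn)
  have h1 := le_abs_self θ
  have h2 := neg_abs_le θ
  have h3 := abs_nonneg θ
  have hpos : 0 < (n : ℝ) - θ := by linarith
  refine ⟨by linarith, by exact_mod_cast (by linarith : (0 : ℝ) < n), fun a => ?_⟩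
  have hm : mesh θ n ^ (-a) = ((n : ℝ) - θ) ^ a := by
    rw [mesh, one_div, Real.inv_rpow hpos.le, Real.rpow_neg hpos.le, inv_inv]
  rw [hm]
  exact ⟨rpow_le_two_rpow_mul (by linarith) hpos (by linarith) (by linarith) a,
    rpow_le_two_rpow_mul (by linarith) hpos (by linarith) (by linarith) a⟩

theorem isBigO_mesh_mul {u : ℕ → ℂ} {w : ℕ → ℝ} {θ a : ℝ} {s : ℂ} (hu : u =O[atTop] w)
    (hw : ∀ᶠ n : ℕ in atTop, 0 ≤ w n ∧ w n ≤ 2 ^ |a| * mesh θ n ^ (-a)) :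
    (fun n : ℕ => (mesh θ n : ℂ) ^ s * u n) =O[atTop] fun n : ℕ => mesh θ n ^ (s.re - a) := by
  have h1 : (fun n : ℕ => (mesh θ n : ℂ) ^ s) =O[atTop] fun n : ℕ => mesh θ n ^ s.re := by
    refine IsBigO.of_bound 1 ?_
    filter_upwards [eventually_mesh θ] with n hn
    rw [Complex.norm_cpow_eq_rpow_re_of_pos (mesh_pos hn.1), one_mul]
    exact le_abs_self _
  have h2 : w =O[atTop] fun n : ℕ => mesh θ n ^ (-a) := by
    refine IsBigO.of_bound (2 ^ |a|) ?_
    filter_upwards [hw, eventually_mesh θ] with n hn hm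
    rw [Real.norm_of_nonneg hn.1, Real.norm_of_nonneg (Real.rpow_nonneg (mesh_pos hm.1).le _)]
    exact hn.2
  refine (h1.mul (hu.trans h2)).congr' EventuallyEq.rfl ?_
  filter_upwards [eventually_mesh θ] with n hn
  rw [← Real.rpow_add (mesh_pos hn.1), sub_eq_add_neg]

theorem convergent_ngGen (α : ℂ) (θ : ℝ) {p : ℕ} (hp : 1 ≤ p) :
    Convergent α θ p (weights (ngGen α θ p)) := by
  intro β hβ
  -- So many terms that the remainder decays fast enough for `conv_isBigO`; adding `p` ensures `p ≤
  -- M`, needed to split the double sum by degree.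
  obtain ⟨M₀, hM₀⟩ := exists_nat_gt (|α.re - 1| + β.re)
  set M := p + M₀ with hM
  have hMr : |α.re - 1| + (β.re - 1 - M) < -1 := by
    rw [hM]
    push_cast
    linarith [(p.cast_nonneg : (0 : ℝ) ≤ p)]
  have hr := (expansionError_isBigO β 0 (p := M) (by omega)).const_mul_left (Complex.Gamma β)
  have hconv := conv_isBigO (weights_ngGen_isBigO α θ p) hr hMr
  have hA := isBigO_mesh_mul (θ := θ) (a := α.re - 1) (s := α + β - 1) hconv <| by
    filter_upwards [eventually_mesh θ] with n hn
    exact ⟨by positivity, (hn.2.2 _).2⟩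
  have htail : (fun n : ℕ => Complex.Gamma β *
      (∑ i ∈ Finset.range p, ∑ m ∈ Finset.Ico (p - i) M,
        ngCoeff α θ i * ngCoeff β 0 m * binCoeff (α + β - (i + m : ℕ)) n -
      expansionError (α + β) θ p n)) =O[atTop]
        fun n : ℕ => (n : ℝ) ^ ((α + β).re - 1 - p) := by
    refine IsBigO.const_mul_left (IsBigO.sub ?_ (expansionError_isBigO _ θ hp)) _
    refine IsBigO.fun_sum fun i _ => IsBigO.fun_sum fun m hm =>
      (binCoeff_isBigO_of_le ?_).const_mul_left _
    have him : (p : ℝ) ≤ (i + m : ℕ) := by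
      have := (Finset.mem_Ico.mp hm).1
      exact_mod_cast (by omega : p ≤ i + m)
    rw [Complex.sub_re, Complex.natCast_re]
    linarith
  have hB := isBigO_mesh_mul (θ := θ) (a := (α + β).re - 1 - p) (s := α + β - 1) htail <| by
    filter_upwards [eventually_mesh θ] with n hn
    exact ⟨by positivity, (hn.2.2 _).1⟩
  have hpow : ∀ᶠ n : ℕ in atTop, mesh θ n ^ ((α + β - 1).re - (α.re - 1)) =
      ‖((mesh θ n : ℝ) : ℂ) ^ β‖ ∧
      mesh θ n ^ ((α + β - 1).re - ((α + β).re - 1 - p)) = mesh θ n ^ p := by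
    filter_upwards [eventually_mesh θ] with n hn
    rw [Complex.norm_cpow_eq_rpow_re_of_pos (mesh_pos hn.1), ← Real.rpow_natCast]
    constructor <;> congr 1 <;> simp only [Complex.sub_re, Complex.add_re, Complex.one_re] <;> ring
  have hA' : _ =O[atTop] fun n : ℕ => ‖((mesh θ n : ℝ) : ℂ) ^ β‖ + mesh θ n ^ p := hA.trans <| by
    refine IsBigO.of_bound 1 ?_
    filter_upwards [hpow, eventually_mesh θ] with n hn hm
    have h1 := pow_pos (mesh_pos hm.1) p
    have h2 := norm_nonneg (((mesh θ n : ℝ) : ℂ) ^ β)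
    rw [hn.1, Real.norm_of_nonneg h2, Real.norm_of_nonneg (by positivity)]
    linarith
  have hB' : _ =O[atTop] fun n : ℕ => ‖((mesh θ n : ℝ) : ℂ) ^ β‖ + mesh θ n ^ p := hB.trans <| by
    refine IsBigO.of_bound 1 ?_
    filter_upwards [hpow, eventually_mesh θ] with n hn hm
    have h1 := pow_pos (mesh_pos hm.1) p
    have h2 := norm_nonneg (((mesh θ n : ℝ) : ℂ) ^ β)
    rw [hn.2, Real.norm_of_nonneg h1.le, Real.norm_of_nonneg (by positivity)]
    linarith
  refine (hA'.add hB').congr' ?_ EventuallyEq.rfl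
  filter_upwards [eventually_mesh θ] with n hn
  exact (errorAtOne_eq hβ α (by omega) hn.1).symm

end SCQ

theorem corollary2 (α : ℂ) (θ : ℝ) (p : ℕ) (hp : 1 ≤ p) :
    SCQ.Convergent α θ p (SCQ.weights (SCQ.ngGen α θ p)) :=
  SCQ.convergent_ngGen α θ hp
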